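/- Let $r\ge 2$ be an integer and let $E:\mathbb S^1\to\mathbb S^1$, $\mathbb S^1=\mathbb R/\mathbb Z$, be a $\mathscr C^r$ expanding map of degree $\ell\ge 2$; thus there is $\lambda>1$ with $E'(x)\ge\lambda$ for all $x$, and we fix such a $\lambda$. For $\tau\in\mathscr C^r(\mathbb S^1)=\mathscr C^r(\mathbb S^1;\mathbb R)$ (with the $\mathscr C^r$ topology) let $f=f_{E,\tau}:\mathbb T^2\to\mathbb T^2$, $f(x,s)=(E(x),\,s+\tau(x)\bmod 1)$, so that $$Df(x,s)=\begin{pmatrix}E'(x)&0\\ \tau'(x)&1\end{pmatrix}.$$ For $R>\|\tau'\|_\infty$ let $\mathscr K_R=\{(\xi,\eta)\in\mathbb R^2:|\eta|\le \tfrac{R}{\lambda-1}|\xi|\}$, and for $n\ge 1$ put $$\mathfrak n(\tau,R;n)=\sup_{z\in\mathbb T^2}\ \sup_{v\in\mathbb R^2,\,|v|=1}\#\{\zeta\in f^{-n}(z)\mid v\in Df^n(\zeta)\mathscr K_R\},\qquad \mathfrak n(\tau)=\lim_{n\to\infty}\mathfrak n(\tau,R;n)^{1/n}.$$ (The limit exists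 and depends neither on $R>\|\tau'\|_\infty$ nor on the choice of $\lambda$.) One says that $f_{E,\tau}$ is partially captive if $\mathfrak n(\tau)=1$. Theorem. For every $\varrho>1$ there is an open dense subset $\mathscr V\subset\mathscr C^r(\mathbb S^1)$ such that $\mathfrak n(\tau)<\varrho$ for every $\tau\in\mathscr V$. Consequently, there is a residual subset $\mathscr R\subset\mathscr C^r(\mathbb S^1)$ such that $\mathfrak n(\tau)=1$ for every $\tau\in\mathscr R$; that is, for fixed $E$, partial captivity is a $\mathscr C^r$-generic condition on $\tau$. -/

import Mathlib

open Filter Topology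
open scoped ENNReal

noncomputable section

namespace PartialCaptivity

/-- The real functions on the circle `ℝ / ℤ` that are of class `C^r`: their lifts to `ℝ` are. -/
def crSubmodule (r : ℕ) : Submodule ℝ (UnitAddCircle → ℝ) where
  carrier := {τ | ContDiff ℝ r (fun t : ℝ => τ (t : UnitAddCircle))}
  add_mem' := by
    intro a b ha hb
    have ha' : ContDiff ℝ r (fun t : ℝ => a (t : UnitAddCircle)) := ha
    have hb' : ContDiff ℝ r (fun t : ℝ => b (t : UnitAddCircle)) := hb
    exact ha'.add hb'
  zero_mem' := by
    change ContDiff ℝ r (fun _ : ℝ => (0 : ℝ))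
    exact contDiff_const
  smul_mem' := by
    intro c a ha
    change ContDiff ℝ r (fun t : ℝ => c • a (t : UnitAddCircle))
    have ha' : ContDiff ℝ r (fun t : ℝ => a (t : UnitAddCircle)) := ha
    exact ha'.const_smul c

/-- The space `C^r(S¹)` of real-valued `C^r` functions on the circle. It is a type of its own, so
that it carries the `C^r` topology defined below and not the topology of pointwise convergence. -/
def CrCircle (r : ℕ) : Type := crSubmodule r

namespace CrCircle

variable {r : ℕ}

instance : AddCommGroup (CrCircle r) := inferInstanceAs (AddCommGroup (crSubmodule r))

instance : Module ℝ (CrCircle r) := inferInstanceAs (Module ℝ (crSubmodule r))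

instance : FunLike (CrCircle r) UnitAddCircle ℝ where
  coe τ := τ.1
  coe_injective := Subtype.val_injective

/-- The lift of `τ` to a 1-periodic function on `ℝ`. -/
def onReal (τ : CrCircle r) (t : ℝ) : ℝ := τ (t : UnitAddCircle)

theorem contDiff_onReal (τ : CrCircle r) : ContDiff ℝ r τ.onReal := τ.2

theorem onReal_add (τ σ : CrCircle r) : (τ + σ).onReal = τ.onReal + σ.onReal := rfl

theorem onReal_smul (c : ℝ) (τ : CrCircle r) : (c • τ).onReal = c • τ.onReal := rfl

theorem periodic_iteratedDeriv (k : ℕ) (τ : CrCircle r) :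
    Function.Periodic (iteratedDeriv k τ.onReal) 1 := by
  intro t
  have h : (fun s : ℝ => τ.onReal (s + 1)) = τ.onReal := by
    funext s
    simp [onReal]
  have h2 := congrFun (iteratedDeriv_comp_add_const k τ.onReal 1) t
  rw [h] at h2
  exact h2.symm

/-- The `k`-th derivative of `τ`, as a function on the circle. -/
def iterDeriv (k : ℕ) (τ : CrCircle r) : UnitAddCircle → ℝ :=
  (periodic_iteratedDeriv k τ).lift

theorem iterDeriv_coe (k : ℕ) (τ : CrCircle r) (t : ℝ) :
    τ.iterDeriv k (t : UnitAddCircle) = iteratedDeriv k τ.onReal t := rfl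

theorem continuous_iterDeriv {k : ℕ} (hk : k ≤ r) (τ : CrCircle r) :
    Continuous (τ.iterDeriv k) := by
  refine continuous_coinduced_dom.mpr ?_
  exact τ.contDiff_onReal.continuous_iteratedDeriv k (by exact_mod_cast hk)

/-- The tuple `(τ, τ', …, τ^(r))` of continuous functions on the circle. -/
def jet (r : ℕ) : CrCircle r →ₗ[ℝ] (Fin (r + 1) → C(UnitAddCircle, ℝ)) where
  toFun τ k := ⟨τ.iterDeriv k, τ.continuous_iterDeriv (Nat.lt_succ_iff.mp k.2)⟩
  map_add' τ σ := by
    funext k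
    ext x
    induction x using QuotientAddGroup.induction_on with
    | H t =>
      have hk : ((k : ℕ) : WithTop ℕ∞) ≤ (r : WithTop ℕ∞) := by
        exact_mod_cast Nat.lt_succ_iff.mp k.2
      exact iteratedDeriv_add (τ.contDiff_onReal.contDiffAt.of_le hk)
        (σ.contDiff_onReal.contDiffAt.of_le hk)
  map_smul' c τ := by
    funext k
    ext x
    induction x using QuotientAddGroup.induction_on with
    | H t =>
      have hk : ((k : ℕ) : WithTop ℕ∞) ≤ (r : WithTop ℕ∞) := by
        exact_mod_cast Nat.lt_succ_iff.mp k.2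
      exact iteratedDeriv_const_smul (τ.contDiff_onReal.contDiffAt.of_le hk) c

theorem jet_injective (r : ℕ) : Function.Injective (jet r) := by
  intro τ σ h
  apply DFunLike.ext
  intro x
  induction x using QuotientAddGroup.induction_on with
  | H t =>
    have h0 := DFunLike.congr_fun (congrFun h 0) (t : UnitAddCircle)
    change iteratedDeriv 0 τ.onReal t = iteratedDeriv 0 σ.onReal t at h0
    rw [iteratedDeriv_zero, iteratedDeriv_zero] at h0
    exact h0

/-- The `C^r` norm `‖τ‖ = max_{0 ≤ k ≤ r} sup_x |τ^(k)(x)|`. -/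
instance : NormedAddCommGroup (CrCircle r) :=
  NormedAddCommGroup.induced (CrCircle r) (Fin (r + 1) → C(UnitAddCircle, ℝ)) (jet r)
    (jet_injective r)

instance : NormedSpace ℝ (CrCircle r) :=
  NormedSpace.induced ℝ (CrCircle r) (Fin (r + 1) → C(UnitAddCircle, ℝ)) (jet r)

/-- The derivative `τ'` on the circle. -/
def derivative (τ : CrCircle r) (x : UnitAddCircle) : ℝ := τ.iterDeriv 1 x

/-- The supremum norm `‖τ'‖_∞`. -/
def supDerivative (τ : CrCircle r) : ℝ := ⨆ x : UnitAddCircle, |τ.derivative x|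

end CrCircle

/-- A `C^r` expanding map `E` of the circle, of degree `ℓ ≥ 2`, together with a lift of it to the
real line. -/
structure ExpandingMap (r : ℕ) where
  /-- the map of the circle -/
  toFun : UnitAddCircle → UnitAddCircle
  /-- a lift to the line -/
  lift : ℝ → ℝ
  /-- the degree -/
  degree : ℕ
  coe_lift : ∀ t : ℝ, toFun (t : UnitAddCircle) = (lift t : UnitAddCircle)
  lift_add_one : ∀ t : ℝ, lift (t + 1) = lift t + degree
  two_le_degree : 2 ≤ degree
  contDiff_lift : ContDiff ℝ r lift
  expanding : ∃ lam : ℝ, 1 < lam ∧ ∀ t : ℝ, lam ≤ deriv lift t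

namespace ExpandingMap

variable {r : ℕ}

theorem periodic_deriv_lift (E : ExpandingMap r) : Function.Periodic (deriv E.lift) 1 := by
  intro t
  have h : (fun s : ℝ => E.lift (s + 1)) = fun s => E.lift s + E.degree :=
    funext E.lift_add_one
  rw [← deriv_comp_add_const, h, deriv_add_const]

/-- The derivative `E'`, a real function on the circle. -/
def derivative (E : ExpandingMap r) : UnitAddCircle → ℝ := E.periodic_deriv_lift.lift

end ExpandingMap

variable {r : ℕ}

/-- The map `f(x, s) = (E(x), s + τ(x) mod 1)` of the torus. -/
def skewProduct (E : ExpandingMap r) (τ : CrCircle r) (z : UnitAddCircle × UnitAddCircle) :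
    UnitAddCircle × UnitAddCircle :=
  (E.toFun z.1, z.2 + ((τ z.1 : ℝ) : UnitAddCircle))

/-- The Jacobian matrix `Df(z)`. -/
def jacobian (E : ExpandingMap r) (τ : CrCircle r) (z : UnitAddCircle × UnitAddCircle) :
    Matrix (Fin 2) (Fin 2) ℝ :=
  !![E.derivative z.1, 0; τ.derivative z.1, 1]

/-- The Jacobian matrix `Df^n(z) = Df(f^(n-1)(z)) ⋯ Df(f(z)) Df(z)` of the `n`-th iterate. -/
def jacobianIter (E : ExpandingMap r) (τ : CrCircle r) :
    ℕ → UnitAddCircle × UnitAddCircle → Matrix (Fin 2) (Fin 2) ℝ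
  | 0, _ => 1
  | n + 1, z => jacobian E τ ((skewProduct E τ)^[n] z) * jacobianIter E τ n z

/-- The cone of the vectors `(ξ, η)` with `|η| ≤ ϑ |ξ|`. -/
def cone (ϑ : ℝ) : Set (Fin 2 → ℝ) := {v | |v 1| ≤ ϑ * |v 0|}

/-- The set of the `ζ ∈ f^(-n)(z)` with `v ∈ Df^n(ζ) K_R`, where `K_R` is the cone with
`ϑ = R / (lam - 1)`. -/
def preimagesSeeing (E : ExpandingMap r) (τ : CrCircle r) (lam R : ℝ) (n : ℕ)
    (z : UnitAddCircle × UnitAddCircle) (v : Fin 2 → ℝ) : Set (UnitAddCircle × UnitAddCircle) :=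
  {ζ | (skewProduct E τ)^[n] ζ = z ∧
    v ∈ (jacobianIter E τ n ζ).mulVec '' cone (R / (lam - 1))}

/-- `𝔫(τ, R; n)`: the supremum, over the points `z` and the unit vectors `v`, of the number of
`ζ ∈ f^(-n)(z)` with `v ∈ Df^n(ζ) K_R`. -/
def coneCount (E : ExpandingMap r) (τ : CrCircle r) (lam R : ℝ) (n : ℕ) : ℕ∞ :=
  ⨆ (z : UnitAddCircle × UnitAddCircle) (v : Fin 2 → ℝ) (_ : v 0 ^ 2 + v 1 ^ 2 = 1),
    (preimagesSeeing E τ lam R n z v).encard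

/-- `𝔫(τ) = L`: for every constant `lam > 1` with `lam ≤ E'` and every `R > ‖τ'‖_∞`, the limit of
`𝔫(τ, R; n)^(1/n)` as `n → ∞` exists and equals `L`. -/
def IsGrowthRate (E : ExpandingMap r) (τ : CrCircle r) (L : ℝ≥0∞) : Prop :=
  ∀ lam R : ℝ, 1 < lam → (∀ x : UnitAddCircle, lam ≤ E.derivative x) → τ.supDerivative < R →
    Tendsto (fun n : ℕ => ((coneCount E τ lam R n : ℕ∞) : ℝ≥0∞) ^ ((1 : ℝ) / (n : ℝ)))
      atTop (𝓝 L)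

/-- `f` is partially captive if `𝔫(τ) = 1`. -/
def PartiallyCaptive (E : ExpandingMap r) (τ : CrCircle r) : Prop := IsGrowthRate E τ 1

end PartialCaptivity

end

/-! Let `G` be the inverse of a lift of `E`. The preimages under the `n`-th iterate of a point over
`y` are given by `G^n (y + m)`, `0 ≤ m < degree ^ n`, and the image of the cone there is the set of
directions whose slope is within `ϑ * weight` of `slope`. So `𝔫(τ, R; n)` is the largest number of
these intervals of slopes with a common point: this is `multiplicity`, by `coneCount_eq`.

Splitting a branch of order `k + n` into branches of orders `k` and `n` makes the multiplicity
submultiplicative (`multiplicity_add_le`). By Fekete's lemma the growth rate exists and is an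
infimum, so it is less than `ϱ` as soon as the multiplicity is less than `ϱ ^ n` for one `n ≥ 1`.
Such an inequality survives small perturbations of `τ` if the cone is shrunk slightly; this gives
openness. The residual set is the intersection over `ϱ = 1 + 1 / (k + 1)`.

Density comes from a random perturbation `τ + ∑ t_i φ_i`, where the `φ_i'` are narrow bumps that
cover the circle. If the multiplicity `a n` is at least `ϱ ^ n` for all `n ≥ 1`, then `a n ≥ A * a
(n - q)` infinitely often, provided `A ≤ ϱ ^ (q / 2)` (`exists_lt_pow_of_lt_mul`). At such an `n`
few of the overlapping branches share an initial part of order `q`, so at least half of the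
`p`-tuples of them are in general position: the point `G^q` of each is away from the first `K`
points of the orbits of the others. For such a tuple the slopes depend on `t` through a matrix with
a nearly diagonal minor (`exists_minor`), so all `p` of them are near a given `s` only for a set of
`t` of volume at most a constant times the product of the weights (`volume_affine_box_le`).

The weights of all branches of order `n` have a bounded sum (`sum_weight_le`), hence by Markov's
inequality the parameters with at least `ϱ ^ (n p) / 2` such tuples at a given `(y, s)` have volume
`O(ϱ ^ (-n p))`. Bounded distortion reduces all `(y, s)` to a grid of `O((degree * Lam ^ 2) ^ n)`
points, where `Lam` bounds `E'`. When `p` is large the total volumes are summable in `n`, and by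
Borel–Cantelli almost every `t` is bad for finitely many `n` only. -/

namespace PartialCaptivity

/-! ### Inverse branches on the line: weights, slopes and distortion. -/

/-- The inverse `G` of a lift of an orientation preserving covering of the circle of degree
`degree`, with its derivative `rate`. -/
structure InverseLift where
  /-- the inverse of the lift -/
  toFun : ℝ → ℝ
  /-- its derivative -/
  rate : ℝ → ℝ
  /-- the degree of the covering -/
  degree : ℕ
  degree_pos : 0 < degree
  hasDerivAt : ∀ u, HasDerivAt toFun (rate u) u
  map_add_degree : ∀ u, toFun (u + degree) = toFun u + 1
  rate_pos : ∀ u, 0 < rate u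

namespace InverseLift

variable (G : InverseLift)

/-- The derivative of the `n`-th iterate of `G`. -/
def weight : ℕ → ℝ → ℝ
  | 0, _ => 1
  | n + 1, u => weight n (G.toFun u) * G.rate u

/-- The derivative of `∑_{1 ≤ k ≤ n} τ ∘ G^k`, in terms of `g = τ'`: the slope of the image of the
horizontal direction under the branch of the `n`-th iterate given by `u`. -/
def slope (g : ℝ → ℝ) : ℕ → ℝ → ℝ
  | 0, _ => 0
  | n + 1, u => (slope g n (G.toFun u) + g (G.toFun u)) * G.rate u

theorem map_add_degree_mul_nat (u : ℝ) (i : ℕ) :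
    G.toFun (u + G.degree * i) = G.toFun u + i := by
  induction i with
  | zero => simp
  | succ i ih =>
    have h : u + G.degree * ((i + 1 : ℕ) : ℝ) = (u + G.degree * i) + G.degree := by
      push_cast; ring
    rw [h, G.map_add_degree, ih]; push_cast; ring

theorem map_add_degree_mul (u : ℝ) (i : ℤ) :
    G.toFun (u + G.degree * i) = G.toFun u + i := by
  obtain ⟨n, rfl | rfl⟩ := i.eq_nat_or_neg
  · exact_mod_cast G.map_add_degree_mul_nat u n
  · have h := G.map_add_degree_mul_nat (u + G.degree * ((-(n : ℤ) : ℤ) : ℝ)) n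
    have e : u + G.degree * ((-(n : ℤ) : ℤ) : ℝ) + G.degree * n = u := by push_cast; ring
    rw [e] at h
    rw [h]; push_cast; ring

theorem rate_add_degree (u : ℝ) : G.rate (u + G.degree) = G.rate u := by
  have h1 := (G.hasDerivAt (u + G.degree)).comp_add_const u (G.degree : ℝ)
  have h2 : HasDerivAt (fun x => G.toFun (x + G.degree)) (G.rate u) u := by
    simp only [G.map_add_degree]
    exact (G.hasDerivAt u).add_const 1
  exact h1.unique h2

theorem rate_add_degree_mul (u : ℝ) (i : ℤ) : G.rate (u + G.degree * i) = G.rate u := by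
  have hp : Function.Periodic G.rate (G.degree : ℝ) := G.rate_add_degree
  have := hp.int_mul i u
  rwa [mul_comm] at this

/-- Translation by a multiple of `degree ^ n` moves the end of a branch of order `n` by an integer,
which is invisible on the circle. Hence the branches of order `n` at `y` are indexed by residues
modulo `degree ^ n`. -/
theorem iterate_add_pow_mul (n : ℕ) (u : ℝ) (i : ℤ) :
    G.toFun^[n] (u + (G.degree : ℝ) ^ n * i) = G.toFun^[n] u + i := by
  induction n generalizing u i with
  | zero => simp
  | succ n ih =>
    have h : u + (G.degree : ℝ) ^ (n + 1) * i =
        u + G.degree * (((G.degree : ℤ) ^ n * i : ℤ) : ℝ) := by push_cast; ring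
    rw [Function.iterate_succ_apply, Function.iterate_succ_apply, h, map_add_degree_mul, ← ih]
    push_cast; rfl

theorem weight_add_pow_mul (n : ℕ) (u : ℝ) (i : ℤ) :
    G.weight n (u + (G.degree : ℝ) ^ n * i) = G.weight n u := by
  induction n generalizing u i with
  | zero => simp [weight]
  | succ n ih =>
    have h : u + (G.degree : ℝ) ^ (n + 1) * i =
        u + G.degree * (((G.degree : ℤ) ^ n * i : ℤ) : ℝ) := by push_cast; ring
    have := ih (G.toFun u) i
    rw [weight, weight, h, map_add_degree_mul, rate_add_degree_mul]
    push_cast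
    rw [this]

theorem slope_add_pow_mul {g : ℝ → ℝ} (hg : Function.Periodic g 1) (n : ℕ) (u : ℝ) (i : ℤ) :
    G.slope g n (u + (G.degree : ℝ) ^ n * i) = G.slope g n u := by
  induction n generalizing u i with
  | zero => simp [slope]
  | succ n ih =>
    have h : u + (G.degree : ℝ) ^ (n + 1) * i =
        u + G.degree * (((G.degree : ℤ) ^ n * i : ℤ) : ℝ) := by push_cast; ring
    have := ih (G.toFun u) i
    have h2 := hg.int_mul ((G.degree : ℤ) ^ n * i) (G.toFun u)
    rw [mul_one] at h2
    rw [slope, slope, h, map_add_degree_mul, rate_add_degree_mul, h2]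
    push_cast
    rw [this]

theorem weight_add (k n : ℕ) (u : ℝ) :
    G.weight (k + n) u = G.weight n (G.toFun^[k] u) * G.weight k u := by
  induction k generalizing u with
  | zero => simp [weight]
  | succ k ih =>
    rw [show k + 1 + n = (k + n) + 1 by ring, weight, weight, ih, Function.iterate_succ_apply]
    ring

theorem slope_add (g : ℝ → ℝ) (k n : ℕ) (u : ℝ) :
    G.slope g (k + n) u =
      G.slope g k u + G.weight k u * G.slope g n (G.toFun^[k] u) := by
  induction k generalizing u with
  | zero => simp [weight, slope]
  | succ k ih =>
    rw [show k + 1 + n = (k + n) + 1 by ring, slope, slope, weight, ih,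
      Function.iterate_succ_apply]
    ring

theorem slope_add_smul (g φ : ℝ → ℝ) (c : ℝ) (n : ℕ) (u : ℝ) :
    G.slope (fun x => g x + c * φ x) n u = G.slope g n u + c * G.slope φ n u := by
  induction n generalizing u with
  | zero => simp [slope]
  | succ n ih => simp only [slope, ih]; ring

/-- The slope is affine in the parameters of a finite-dimensional perturbation, so linear algebra
applies to it. -/
theorem slope_add_sum {ι : Type*} (s : Finset ι) (g : ℝ → ℝ) (φ : ι → ℝ → ℝ) (t : ι → ℝ) (n : ℕ)
    (u : ℝ) :
    G.slope (fun x => g x + ∑ i ∈ s, t i * φ i x) n u =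
      G.slope g n u + ∑ i ∈ s, t i * G.slope (φ i) n u := by
  induction n generalizing u with
  | zero => simp [slope]
  | succ n ih =>
    simp only [slope, ih, add_mul, Finset.sum_mul, mul_add, Finset.sum_add_distrib]
    simp only [mul_assoc]
    ring

theorem weight_pos (n : ℕ) (u : ℝ) : 0 < G.weight n u := by
  induction n generalizing u with
  | zero => simp [weight]
  | succ n ih => exact mul_pos (ih _) (G.rate_pos u)

theorem hasDerivAt_iterate (n : ℕ) (u : ℝ) : HasDerivAt G.toFun^[n] (G.weight n u) u := by
  induction n generalizing u with
  | zero => exact hasDerivAt_id u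
  | succ n ih => exact (ih (G.toFun u)).comp u (G.hasDerivAt u)

theorem strictMono : StrictMono G.toFun :=
  strictMono_of_hasDerivAt_pos G.hasDerivAt G.rate_pos

section Contraction

variable {lam : ℝ}

theorem weight_le (hlam : 1 < lam) (h : ∀ u, G.rate u ≤ lam⁻¹) (n : ℕ) (u : ℝ) :
    G.weight n u ≤ lam⁻¹ ^ n := by
  have hl : 0 < lam⁻¹ := inv_pos.2 (zero_lt_one.trans hlam)
  induction n generalizing u with
  | zero => simp [weight]
  | succ n ih =>
    rw [weight, pow_succ]
    exact mul_le_mul (ih _) (h u) (G.rate_pos u).le (by positivity)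

theorem le_weight {Lam : ℝ} (hLam : 0 < Lam) (h : ∀ u, Lam⁻¹ ≤ G.rate u) (n : ℕ) (u : ℝ) :
    Lam⁻¹ ^ n ≤ G.weight n u := by
  have hl : 0 < Lam⁻¹ := by positivity
  induction n generalizing u with
  | zero => simp [weight]
  | succ n ih =>
    rw [weight, pow_succ]
    exact mul_le_mul (ih _) (h u) hl.le (G.weight_pos _ _).le

/-- The cone with `ϑ = R / (lam - 1)` is mapped into itself. -/
theorem abs_slope_add_le (hlam : 1 < lam) (h : ∀ u, G.rate u ≤ lam⁻¹) {g : ℝ → ℝ} {R : ℝ}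
    (hg : ∀ u, |g u| ≤ R) (n : ℕ) (u : ℝ) :
    |G.slope g n u| + R / (lam - 1) * G.weight n u ≤ R / (lam - 1) := by
  have hR : 0 ≤ R := (abs_nonneg _).trans (hg 0)
  have hl : 0 < lam - 1 := by linarith
  induction n generalizing u with
  | zero => simp [slope, weight]
  | succ n ih =>
    rw [slope, weight, abs_mul, abs_of_pos (G.rate_pos u)]
    have h1 : |G.slope g n (G.toFun u) + g (G.toFun u)| ≤
        |G.slope g n (G.toFun u)| + R := (abs_add_le _ _).trans (by gcongr; exact hg _)
    calc _ ≤ (|G.slope g n (G.toFun u)| + R) * G.rate u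
          + R / (lam - 1) * (G.weight n (G.toFun u) * G.rate u) := by
          gcongr; exact (G.rate_pos u).le
      _ = (|G.slope g n (G.toFun u)| + R / (lam - 1) * G.weight n (G.toFun u) + R) *
          G.rate u := by ring
      -- The constant `R / (lam - 1)` is the fixed point of `x ↦ (x + R) / lam`.
      _ ≤ (R / (lam - 1) + R) * lam⁻¹ := by
          have := ih (G.toFun u)
          have h3 := (G.rate_pos u).le
          have h4 := h u
          gcongr
      _ = R / (lam - 1) := by field_simp; ring

theorem abs_slope_le (hlam : 1 < lam) (h : ∀ u, G.rate u ≤ lam⁻¹) {g : ℝ → ℝ} {R : ℝ}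
    (hg : ∀ u, |g u| ≤ R) (n : ℕ) (u : ℝ) : |G.slope g n u| ≤ R / (lam - 1) := by
  have := G.abs_slope_add_le hlam h hg n u
  have hR : 0 ≤ R := (abs_nonneg _).trans (hg 0)
  have : 0 ≤ R / (lam - 1) * G.weight n u :=
    mul_nonneg (div_nonneg hR (by linarith)) (G.weight_pos _ _).le
  linarith

theorem abs_slope_sub_le_of_forall (hlam : 1 < lam) (h : ∀ u, G.rate u ≤ lam⁻¹) {g φ : ℝ → ℝ}
    {R : ℝ} (hg : ∀ u, |φ u - g u| ≤ R) (n : ℕ) (u : ℝ) :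
    |G.slope φ n u - G.slope g n u| ≤ R / (lam - 1) := by
  have := G.abs_slope_le hlam h hg n u
  have e : (fun u => φ u - g u) = fun u => φ u + (-1) * g u := by funext; ring
  rw [e, slope_add_smul] at this
  convert this using 2; ring

theorem abs_map_sub_le (h : ∀ u, G.rate u ≤ lam⁻¹) (u v : ℝ) :
    |G.toFun u - G.toFun v| ≤ lam⁻¹ * |u - v| := by
  have := Convex.norm_image_sub_le_of_norm_hasDerivWithin_le (f := G.toFun) (f' := G.rate)
    (C := lam⁻¹) (s := Set.univ) (x := v) (y := u) (fun x _ => (G.hasDerivAt x).hasDerivWithinAt)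
    (fun x _ => by rw [Real.norm_eq_abs, abs_of_pos (G.rate_pos x)]; exact h x) convex_univ
    (Set.mem_univ _) (Set.mem_univ _)
  simpa using this

/-- Bounded distortion. -/
theorem weight_le_exp_mul (hlam : 1 < lam) (h : ∀ u, G.rate u ≤ lam⁻¹) {B : ℝ} (hB0 : 0 ≤ B)
    (hB : ∀ u v, G.rate u ≤ G.rate v * Real.exp (B * |u - v|)) (n : ℕ) (u v : ℝ) :
    G.weight n u ≤ G.weight n v * Real.exp (B * lam / (lam - 1) * |u - v|) := by
  have hl : 0 < lam - 1 := by linarith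
  induction n generalizing u v with
  | zero =>
    simp only [weight, one_mul]
    exact Real.one_le_exp (by positivity)
  | succ n ih =>
    have h1 := ih (G.toFun u) (G.toFun v)
    have h2 := hB u v
    have h3 := G.abs_map_sub_le h u v
    rw [weight, weight]
    calc _ ≤ (G.weight n (G.toFun v) *
          Real.exp (B * lam / (lam - 1) * |G.toFun u - G.toFun v|)) *
          (G.rate v * Real.exp (B * |u - v|)) :=
          mul_le_mul h1 h2 (G.rate_pos u).le
            (mul_nonneg (G.weight_pos _ _).le (Real.exp_pos _).le)
      _ ≤ (G.weight n (G.toFun v) *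
          Real.exp (B * lam / (lam - 1) * (lam⁻¹ * |u - v|))) *
          (G.rate v * Real.exp (B * |u - v|)) := by
          have := (G.weight_pos n (G.toFun v)).le
          have := (G.rate_pos v).le
          gcongr
      _ = G.weight n (G.toFun v) * G.rate v *
          (Real.exp (B * lam / (lam - 1) * (lam⁻¹ * |u - v|)) * Real.exp (B * |u - v|)) := by
          ring
      _ = _ := by
          rw [← Real.exp_add]
          congr 2
          field_simp
          ring

/-- Up to distortion, `weight n (y + m)` is the length of the image under `G^n` of `[y + m, y + m +
1]`. These images tile an interval of length 1, since `G^n (y + degree ^ n) = G^n y + 1`. -/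
theorem sum_weight_le (hlam : 1 < lam) (h : ∀ u, G.rate u ≤ lam⁻¹) {B : ℝ} (hB0 : 0 ≤ B)
    (hB : ∀ u v, G.rate u ≤ G.rate v * Real.exp (B * |u - v|)) (n : ℕ) (y : ℝ) :
    ∑ m ∈ Finset.range (G.degree ^ n), G.weight n (y + m) ≤
      Real.exp (B * lam / (lam - 1)) := by
  have hl : 0 < lam - 1 := by linarith
  have key : ∀ x, G.weight n x ≤
      Real.exp (B * lam / (lam - 1)) * (G.toFun^[n] (x + 1) - G.toFun^[n] x) := by
    intro x
    obtain ⟨c, hc, hc'⟩ := exists_hasDerivAt_eq_slope G.toFun^[n] (G.weight n)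
      (show x < x + 1 by linarith)
      (fun z _ => (G.hasDerivAt_iterate n z).continuousAt.continuousWithinAt)
      (fun z _ => G.hasDerivAt_iterate n z)
    have e : G.toFun^[n] (x + 1) - G.toFun^[n] x = G.weight n c := by rw [hc']; simp
    rw [e, mul_comm]
    refine (G.weight_le_exp_mul hlam h hB0 hB n x c).trans ?_
    have := (G.weight_pos n c).le
    gcongr
    have : |x - c| ≤ 1 := by rw [abs_le]; constructor <;> linarith [hc.1, hc.2]
    exact mul_le_of_le_one_right (by positivity) this
  calc _ ≤ ∑ m ∈ Finset.range (G.degree ^ n), Real.exp (B * lam / (lam - 1)) *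
        (G.toFun^[n] (y + (m + 1 : ℕ)) - G.toFun^[n] (y + m)) := by
        refine Finset.sum_le_sum fun m _ => (key _).trans (le_of_eq ?_)
        push_cast; rw [add_assoc]
    _ = _ := by
        rw [← Finset.mul_sum, Finset.sum_range_sub (fun m : ℕ => G.toFun^[n] (y + m))]
        have := G.iterate_add_pow_mul n y 1
        push_cast at this ⊢
        rw [mul_one] at this
        rw [this]; simp

/-- The Lipschitz constant does not depend on `n`: it is the fixed point of `L ↦ L / lam + (M + (M /
(lam - 1) + M) * C)`, the recursion that one more step of the slope imposes. -/
theorem abs_slope_sub_le (hlam : 1 < lam) (h : ∀ u, G.rate u ≤ lam⁻¹) {g : ℝ → ℝ} {M C : ℝ}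
    (hC : ∀ u v, |G.rate u - G.rate v| ≤ C * |u - v|)
    (hg : ∀ u, |g u| ≤ M) (hg' : ∀ u v, |g u - g v| ≤ M * |u - v|) (n : ℕ) (u v : ℝ) :
    |G.slope g n u - G.slope g n v| ≤
      (M + (M / (lam - 1) + M) * C) * lam / (lam - 1) * |u - v| := by
  have hl : 0 < lam - 1 := by linarith
  have hM : 0 ≤ M := (abs_nonneg _).trans (hg 0)
  have hC0 : 0 ≤ C := by simpa using (abs_nonneg _).trans (hC 1 0)
  set L := (M + (M / (lam - 1) + M) * C) * lam / (lam - 1) with hL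
  have hL0 : 0 ≤ L := by positivity
  induction n generalizing u v with
  | zero => simp only [slope, sub_self, abs_zero]; positivity
  | succ n ih =>
    have e : G.slope g (n + 1) u - G.slope g (n + 1) v =
        ((G.slope g n (G.toFun u) - G.slope g n (G.toFun v)) +
          (g (G.toFun u) - g (G.toFun v))) * G.rate u +
        (G.slope g n (G.toFun v) + g (G.toFun v)) * (G.rate u - G.rate v) := by
      simp only [slope]; ring
    have h1 := ih (G.toFun u) (G.toFun v)
    have h2 := hg' (G.toFun u) (G.toFun v)
    have h3 := G.abs_map_sub_le h u v
    have h3' : |G.toFun u - G.toFun v| ≤ |u - v| :=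
      h3.trans (mul_le_of_le_one_left (abs_nonneg _) (inv_le_one_of_one_le₀ hlam.le))
    have h4 := G.abs_slope_le hlam h hg n (G.toFun v)
    have h5 := hg (G.toFun v)
    have h6 : lam⁻¹ ≤ 1 := inv_le_one_of_one_le₀ hlam.le
    rw [e]
    calc _ ≤ (|G.slope g n (G.toFun u) - G.slope g n (G.toFun v)| +
          |g (G.toFun u) - g (G.toFun v)|) * G.rate u +
          (|G.slope g n (G.toFun v)| + |g (G.toFun v)|) * |G.rate u - G.rate v| := by
          refine (abs_add_le _ _).trans ?_
          rw [abs_mul, abs_mul, abs_of_pos (G.rate_pos u)]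
          have := (G.rate_pos u).le
          gcongr
          · exact abs_add_le _ _
          · exact abs_add_le _ _
      _ ≤ (L * |u - v| + M * |u - v|) * lam⁻¹ +
          (M / (lam - 1) + M) * (C * |u - v|) := by
          have := (G.rate_pos u).le
          have := h u
          have := hC u v
          have h7 : L * |G.toFun u - G.toFun v| ≤ L * |u - v| := by gcongr
          have h8 : M * |G.toFun u - G.toFun v| ≤ M * |u - v| := by gcongr
          gcongr
          · exact h1.trans h7
          · exact h2.trans h8
      _ ≤ (L * lam⁻¹ + (M + (M / (lam - 1) + M) * C)) * |u - v| := by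
          have : M * |u - v| * lam⁻¹ ≤ M * |u - v| := mul_le_of_le_one_right (by positivity) h6
          nlinarith
      _ = L * |u - v| := by
          congr 1
          rw [hL]
          field_simp
          ring

end Contraction

end InverseLift

end PartialCaptivity

/-! ### Overlaps of inverse branches and their submultiplicativity. -/

namespace PartialCaptivity

namespace InverseLift

variable (G : InverseLift)

/-- The inverse branches of the `n`-th iterate at `y` for which the image of the cone with
parameter `ϑ` contains the direction of slope `s`. -/
noncomputable def hits (ϑ : ℝ) (g : ℝ → ℝ) (n : ℕ) (y s : ℝ) : Finset ℕ :=
  {m ∈ Finset.range (G.degree ^ n) | |G.slope g n (y + m) - s| ≤ ϑ * G.weight n (y + m)}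

/-- The maximal number of inverse branches for which the images of a cone share a direction. -/
noncomputable def multiplicity (ϑ : ℝ) (g : ℝ → ℝ) (n : ℕ) : ℕ :=
  ⨆ p : ℝ × ℝ, (G.hits ϑ g n p.1 p.2).card

theorem mem_hits {ϑ : ℝ} {g : ℝ → ℝ} {n : ℕ} {y s : ℝ} {m : ℕ} :
    m ∈ G.hits ϑ g n y s ↔
      m < G.degree ^ n ∧ |G.slope g n (y + m) - s| ≤ ϑ * G.weight n (y + m) := by
  simp [hits]

theorem card_hits_le_pow (ϑ : ℝ) (g : ℝ → ℝ) (n : ℕ) (y s : ℝ) :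
    (G.hits ϑ g n y s).card ≤ G.degree ^ n :=
  (Finset.card_filter_le _ _).trans (by simp)

theorem bddAbove_card_hits (ϑ : ℝ) (g : ℝ → ℝ) (n : ℕ) :
    BddAbove (Set.range fun p : ℝ × ℝ => (G.hits ϑ g n p.1 p.2).card) :=
  ⟨G.degree ^ n, by rintro _ ⟨p, rfl⟩; exact G.card_hits_le_pow ϑ g n _ _⟩

theorem card_hits_le_multiplicity (ϑ : ℝ) (g : ℝ → ℝ) (n : ℕ) (y s : ℝ) :
    (G.hits ϑ g n y s).card ≤ G.multiplicity ϑ g n :=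
  le_ciSup (G.bddAbove_card_hits ϑ g n) (y, s)

theorem exists_card_hits_eq (ϑ : ℝ) (g : ℝ → ℝ) (n : ℕ) :
    ∃ y s, (G.hits ϑ g n y s).card = G.multiplicity ϑ g n := by
  obtain ⟨p, hp⟩ := Nat.sSup_mem (Set.range_nonempty _) (G.bddAbove_card_hits ϑ g n)
  exact ⟨p.1, p.2, hp⟩

theorem multiplicity_le {ϑ : ℝ} {g : ℝ → ℝ} {n k : ℕ}
    (h : ∀ y s, (G.hits ϑ g n y s).card ≤ k) : G.multiplicity ϑ g n ≤ k := by
  obtain ⟨y, s, hys⟩ := G.exists_card_hits_eq ϑ g n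
  exact hys ▸ h y s

theorem multiplicity_le_pow (ϑ : ℝ) (g : ℝ → ℝ) (n : ℕ) :
    G.multiplicity ϑ g n ≤ G.degree ^ n :=
  G.multiplicity_le fun y s => G.card_hits_le_pow ϑ g n y s

theorem one_le_multiplicity {ϑ : ℝ} (hϑ : 0 ≤ ϑ) (g : ℝ → ℝ) (n : ℕ) :
    1 ≤ G.multiplicity ϑ g n := by
  refine le_trans ?_ (G.card_hits_le_multiplicity ϑ g n 0 (G.slope g n 0))
  rw [Nat.succ_le_iff, Finset.card_pos]
  refine ⟨0, G.mem_hits.2 ⟨pow_pos G.degree_pos n, ?_⟩⟩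
  simp only [Nat.cast_zero, add_zero, sub_self, abs_zero]
  exact mul_nonneg hϑ (G.weight_pos _ _).le

/-- The residue of `m` modulo `degree ^ k` selects the first `k` applications of `G`, and the
quotient selects a branch of order `n` at the point reached. The first `k` steps act on slopes by an
affine map with factor `weight k`, so the condition of being hit rescales. -/
theorem slope_sub_of_decomp {g : ℝ → ℝ} (hg : Function.Periodic g 1) (k n : ℕ) (y s : ℝ)
    (m : ℕ) :
    G.slope g (k + n) (y + m) - s =
      G.weight k (y + (m % G.degree ^ k : ℕ)) *
        (G.slope g n (G.toFun^[k] (y + (m % G.degree ^ k : ℕ)) + (m / G.degree ^ k : ℕ)) -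
          (s - G.slope g k (y + (m % G.degree ^ k : ℕ))) /
            G.weight k (y + (m % G.degree ^ k : ℕ))) ∧
    G.weight (k + n) (y + m) =
      G.weight n (G.toFun^[k] (y + (m % G.degree ^ k : ℕ)) + (m / G.degree ^ k : ℕ)) *
        G.weight k (y + (m % G.degree ^ k : ℕ)) := by
  have e : y + (m : ℝ) = (y + (m % G.degree ^ k : ℕ)) +
      (G.degree : ℝ) ^ k * ((m / G.degree ^ k : ℕ) : ℤ) := by
    rw [add_assoc]
    congr 1
    rw [Int.cast_natCast, ← Nat.cast_pow, ← Nat.cast_mul, ← Nat.cast_add, Nat.mod_add_div]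
  have hw := (G.weight_pos k (y + (m % G.degree ^ k : ℕ))).ne'
  rw [G.slope_add, G.weight_add, e, G.iterate_add_pow_mul, G.weight_add_pow_mul,
    G.slope_add_pow_mul hg, Int.cast_natCast]
  refine ⟨?_, rfl⟩
  field_simp
  ring

theorem div_mem_hits {ϑ : ℝ} {g : ℝ → ℝ} (hg : Function.Periodic g 1) {k n : ℕ} {y s : ℝ}
    {m : ℕ} (hm : m ∈ G.hits ϑ g (k + n) y s) :
    m / G.degree ^ k ∈ G.hits ϑ g n (G.toFun^[k] (y + (m % G.degree ^ k : ℕ)))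
      ((s - G.slope g k (y + (m % G.degree ^ k : ℕ))) /
            G.weight k (y + (m % G.degree ^ k : ℕ))) := by
  obtain ⟨h1, h2⟩ := G.mem_hits.1 hm
  obtain ⟨e1, e2⟩ := G.slope_sub_of_decomp hg k n y s m
  refine G.mem_hits.2 ⟨?_, ?_⟩
  · rw [pow_add] at h1
    exact Nat.div_lt_of_lt_mul h1
  · have hw := G.weight_pos k (y + (m % G.degree ^ k : ℕ))
    rw [e1, e2, abs_mul, abs_of_pos hw, ← mul_assoc, mul_comm] at h2
    exact le_of_mul_le_mul_right h2 hw

/-- The hypothesis says that the branch of order `n` carries the cone with parameter `ϑ` into the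
one with parameter `ϑ'`, so a direction seen after `n + k` steps is in the image of the latter cone
after the remaining `k`. -/
theorem mod_mem_hits {ϑ ϑ' : ℝ} {g : ℝ → ℝ} (hg : Function.Periodic g 1) {k n : ℕ}
    (hϑ : ∀ u, |G.slope g n u| + ϑ * G.weight n u ≤ ϑ') {y s : ℝ}
    {m : ℕ} (hm : m ∈ G.hits ϑ g (k + n) y s) : m % G.degree ^ k ∈ G.hits ϑ' g k y s := by
  obtain ⟨-, h2⟩ := G.mem_hits.1 (G.div_mem_hits hg hm)
  have hw := G.weight_pos k (y + (m % G.degree ^ k : ℕ))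
  refine G.mem_hits.2 ⟨Nat.mod_lt _ (pow_pos G.degree_pos k), ?_⟩
  set u := y + ((m % G.degree ^ k : ℕ) : ℝ)
  set v := G.toFun^[k] u + ((m / G.degree ^ k : ℕ) : ℝ)
  have h3 : |(s - G.slope g k u) / G.weight k u| ≤ ϑ' := by
    have := abs_sub_abs_le_abs_sub ((s - G.slope g k u) / G.weight k u) (G.slope g n v)
    rw [abs_sub_comm] at this
    linarith [hϑ v]
  rw [abs_div, abs_of_pos hw, div_le_iff₀ hw, abs_sub_comm] at h3
  exact h3

theorem card_filter_mod_le (ϑ : ℝ) {g : ℝ → ℝ} (hg : Function.Periodic g 1) (k n : ℕ)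
    (y s : ℝ) (a : ℕ) :
    {m ∈ G.hits ϑ g (k + n) y s | m % G.degree ^ k = a}.card ≤ G.multiplicity ϑ g n := by
  refine le_trans ?_ (G.card_hits_le_multiplicity ϑ g n (G.toFun^[k] (y + a))
    ((s - G.slope g k (y + a)) / G.weight k (y + a)))
  refine Finset.card_le_card_of_injOn (fun m => m / G.degree ^ k) ?_ ?_
  · intro m hm
    obtain ⟨h1, rfl⟩ := Finset.mem_filter.1 hm
    exact G.div_mem_hits hg h1
  · intro m hm m' hm' h
    have h1 := (Finset.mem_filter.1 hm).2
    have h2 := (Finset.mem_filter.1 hm').2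
    have h3 : m / G.degree ^ k = m' / G.degree ^ k := h
    rw [← Nat.mod_add_div m (G.degree ^ k), ← Nat.mod_add_div m' (G.degree ^ k), h1, h2, h3]

/-- At most `multiplicity ϑ' g k` residues occur, and each of them for at most `multiplicity ϑ g n`
quotients. Two different cones are allowed so that the growth rates for different constants can be
compared. -/
theorem multiplicity_add_le {ϑ ϑ' : ℝ} {g : ℝ → ℝ} (hg : Function.Periodic g 1) {k n : ℕ}
    (hϑ : ∀ u, |G.slope g n u| + ϑ * G.weight n u ≤ ϑ') :
    G.multiplicity ϑ g (k + n) ≤ G.multiplicity ϑ g n * G.multiplicity ϑ' g k := by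
  refine G.multiplicity_le fun y s => ?_
  refine (Finset.card_le_mul_card_image (f := fun m => m % G.degree ^ k) _ _
    fun a _ => G.card_filter_mod_le ϑ hg k n y s a).trans ?_
  refine Nat.mul_le_mul_left _ (le_trans (Finset.card_le_card ?_)
    (G.card_hits_le_multiplicity ϑ' g k y s))
  exact Finset.image_subset_iff.2 fun m hm => G.mod_mem_hits hg hϑ hm

end InverseLift

end PartialCaptivity

/-! ### From cones on the torus to overlaps of branches on the line. -/

namespace PartialCaptivity

variable {r : ℕ}

namespace ExpandingMap

variable (E : ExpandingMap r)

theorem deriv_lift_pos (t : ℝ) : 0 < deriv E.lift t := by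
  obtain ⟨lam, h1, h2⟩ := E.expanding
  linarith [h2 t]

theorem strictMono_lift : StrictMono E.lift := strictMono_of_deriv_pos E.deriv_lift_pos

theorem differentiable_lift (hr : r ≠ 0) : Differentiable ℝ E.lift :=
  E.contDiff_lift.differentiable (by exact_mod_cast hr)

theorem sub_le_lift_sub {x y : ℝ} (hr : r ≠ 0) (h : x ≤ y) :
    y - x ≤ E.lift y - E.lift x := by
  obtain ⟨lam, h1, h2⟩ := E.expanding
  have := mul_sub_le_image_sub_of_le_deriv (C := 1) (E.differentiable_lift hr)
    (fun t => h1.le.trans (h2 t)) h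
  simpa using this

theorem surjective_lift (hr : r ≠ 0) : Function.Surjective E.lift := by
  refine (E.differentiable_lift hr).continuous.surjective ?_ ?_
  · refine tendsto_atTop_mono' atTop ?_ (tendsto_atTop_add_const_right atTop (E.lift 0) tendsto_id)
    filter_upwards [eventually_ge_atTop 0] with t ht
    have := E.sub_le_lift_sub hr ht
    simp only [id]; linarith
  · refine tendsto_atBot_mono' atBot ?_ (tendsto_atBot_add_const_right atBot (E.lift 0) tendsto_id)
    filter_upwards [eventually_le_atBot 0] with t ht
    have := E.sub_le_lift_sub hr ht
    simp only [id]; linarith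

/-- The lift as an order isomorphism of the line. -/
noncomputable def liftIso (hr : r ≠ 0) : ℝ ≃o ℝ :=
  E.strictMono_lift.orderIsoOfSurjective E.lift (E.surjective_lift hr)

theorem lift_liftIso_symm (hr : r ≠ 0) (u : ℝ) : E.lift ((E.liftIso hr).symm u) = u :=
  (E.liftIso hr).apply_symm_apply u

/-- The inverse of the lift. -/
noncomputable def inverseLift (hr : r ≠ 0) : InverseLift where
  toFun := (E.liftIso hr).symm
  rate u := (deriv E.lift ((E.liftIso hr).symm u))⁻¹
  degree := E.degree
  degree_pos := by have := E.two_le_degree; omega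
  hasDerivAt u := by
    refine HasDerivAt.of_local_left_inverse (E.liftIso hr).symm.continuous.continuousAt
      (E.differentiable_lift hr _).hasDerivAt (E.deriv_lift_pos _).ne' ?_
    exact Eventually.of_forall fun y => E.lift_liftIso_symm hr y
  map_add_degree u := by
    apply E.strictMono_lift.injective
    rw [lift_liftIso_symm, E.lift_add_one, lift_liftIso_symm]
  rate_pos u := inv_pos.2 (E.deriv_lift_pos _)

theorem lift_inverseLift (hr : r ≠ 0) (u : ℝ) : E.lift ((E.inverseLift hr).toFun u) = u :=
  E.lift_liftIso_symm hr u

theorem leftInverse_inverseLift (hr : r ≠ 0) :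
    Function.LeftInverse (E.inverseLift hr).toFun E.lift :=
  fun u => (E.liftIso hr).symm_apply_apply u

theorem iterate_lift_inverseLift (hr : r ≠ 0) (n : ℕ) (u : ℝ) :
    E.lift^[n] ((E.inverseLift hr).toFun^[n] u) = u :=
  Function.RightInverse.iterate (f := E.lift) (E.lift_inverseLift hr) n u

theorem iterate_inverseLift_lift (hr : r ≠ 0) (n : ℕ) (u : ℝ) :
    (E.inverseLift hr).toFun^[n] (E.lift^[n] u) = u :=
  Function.LeftInverse.iterate (E.leftInverse_inverseLift hr) n u

theorem rate_inverseLift (hr : r ≠ 0) (u : ℝ) :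
    (E.inverseLift hr).rate u = (deriv E.lift ((E.inverseLift hr).toFun u))⁻¹ := rfl

theorem derivative_coe (t : ℝ) : E.derivative (t : UnitAddCircle) = deriv E.lift t := rfl

theorem rate_inverseLift_le (hr : r ≠ 0) {lam : ℝ} (h0 : 0 < lam)
    (h : ∀ x, lam ≤ E.derivative x) (u : ℝ) : (E.inverseLift hr).rate u ≤ lam⁻¹ := by
  rw [rate_inverseLift]
  exact inv_anti₀ h0 (h ((E.inverseLift hr).toFun u : ℝ))

end ExpandingMap

namespace CrCircle

theorem derivative_coe (τ : CrCircle r) (t : ℝ) :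
    τ.derivative (t : UnitAddCircle) = deriv τ.onReal t := by
  rw [derivative, iterDeriv_coe, iteratedDeriv_one]

theorem periodic_deriv_onReal (τ : CrCircle r) : Function.Periodic (deriv τ.onReal) 1 := by
  have := periodic_iteratedDeriv 1 τ
  rwa [iteratedDeriv_one] at this

end CrCircle

theorem iterate_skewProduct (E : ExpandingMap r) (τ : CrCircle r) (n : ℕ) (x : ℝ)
    (σ : UnitAddCircle) :
    (skewProduct E τ)^[n] ((x : UnitAddCircle), σ) =
      ((E.lift^[n] x : UnitAddCircle),
        σ + ((∑ k ∈ Finset.range n, τ.onReal (E.lift^[k] x) : ℝ) : UnitAddCircle)) := by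
  induction n with
  | zero => simp
  | succ n ih =>
    rw [Function.iterate_succ_apply', ih, Function.iterate_succ_apply', skewProduct]
    simp only
    rw [E.coe_lift, Finset.sum_range_succ, AddCircle.coe_add, add_assoc]
    rfl

theorem jacobianIter_inverseLift (E : ExpandingMap r) (hr : r ≠ 0) (τ : CrCircle r) (n : ℕ)
    (u : ℝ) (σ : UnitAddCircle) :
    jacobianIter E τ n (((E.inverseLift hr).toFun^[n] u : ℝ), σ) =
      !![((E.inverseLift hr).weight n u)⁻¹, 0;
        (E.inverseLift hr).slope (deriv τ.onReal) n u / (E.inverseLift hr).weight n u, 1] := by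
  induction n generalizing u with
  | zero =>
    simp only [jacobianIter, InverseLift.weight, InverseLift.slope, inv_one, zero_div]
    exact Matrix.one_fin_two
  | succ n ih =>
    have hw := ((E.inverseLift hr).weight_pos n ((E.inverseLift hr).toFun u)).ne'
    have hd := (E.deriv_lift_pos ((E.inverseLift hr).toFun u)).ne'
    rw [jacobianIter, Function.iterate_succ_apply, ih, iterate_skewProduct,
      E.iterate_lift_inverseLift, jacobian]
    simp only
    rw [E.derivative_coe, τ.derivative_coe, Matrix.mul_fin_two, InverseLift.weight,
      InverseLift.slope, E.rate_inverseLift]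
    congr! 1
    ext i j
    fin_cases i <;> fin_cases j <;> simp <;> field_simp
    ring

theorem mem_image_cone_iff {w a ϑ : ℝ} (hw : 0 < w) {v : Fin 2 → ℝ} (hv : v 0 ≠ 0) :
    v ∈ (!![w⁻¹, 0; a / w, 1] : Matrix (Fin 2) (Fin 2) ℝ).mulVec '' cone ϑ ↔
      |a - v 1 / v 0| ≤ ϑ * w := by
  have hv' : 0 < |v 0| := abs_pos.2 hv
  have e : |a - v 1 / v 0| = |v 1 - a * v 0| / |v 0| := by
    rw [← abs_div, abs_sub_comm]
    congr 1
    field_simp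
  rw [e, div_le_iff₀ hv']
  constructor
  · rintro ⟨c, hc, rfl⟩
    have hc' : |c 1| ≤ ϑ * |c 0| := hc
    simp only [Matrix.mulVec, dotProduct, Fin.sum_univ_two, Matrix.of_apply, Matrix.cons_val_zero,
      Matrix.cons_val_one, zero_mul, add_zero, one_mul]
    rw [show a / w * c 0 + c 1 - a * (w⁻¹ * c 0) = c 1 by field_simp; ring, abs_mul,
      abs_of_pos (inv_pos.2 hw)]
    refine hc'.trans (le_of_eq ?_)
    field_simp
  · intro h
    refine ⟨![w * v 0, v 1 - a * v 0], ?_, ?_⟩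
    · simp only [cone, Set.mem_ofPred_eq, Matrix.cons_val_one, Matrix.cons_val_zero, abs_mul,
        abs_of_pos hw]
      rwa [← mul_assoc]
    · funext i
      fin_cases i <;>
        simp [Matrix.mulVec, dotProduct, Fin.sum_univ_two] <;> field_simp
      ring

theorem coe_eq_coe_iff_exists_int {x y : ℝ} :
    (x : UnitAddCircle) = y ↔ ∃ i : ℤ, x = y + i := by
  rw [← sub_eq_zero, ← AddCircle.coe_sub, AddCircle.coe_eq_zero_iff]
  refine exists_congr fun i => ?_
  rw [zsmul_eq_mul, mul_one, eq_comm, sub_eq_iff_eq_add']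

/-- A preimage of order `n` is determined by its branch, because the second coordinate is then
forced by the skew product; the cone condition is `mem_image_cone_iff` for the triangular matrix
`jacobianIter_inverseLift`. -/
theorem preimagesSeeing_eq (E : ExpandingMap r) (hr : r ≠ 0) (τ : CrCircle r) (lam R : ℝ) (n : ℕ)
    (y : ℝ) (σ : UnitAddCircle) {v : Fin 2 → ℝ} (hv : v 0 ≠ 0) :
    preimagesSeeing E τ lam R n (y, σ) v =
      (fun m : ℕ => (((E.inverseLift hr).toFun^[n] (y + m) : UnitAddCircle),
        σ - ((∑ k ∈ Finset.range n,
          τ.onReal (E.lift^[k] ((E.inverseLift hr).toFun^[n] (y + m))) : ℝ) : UnitAddCircle))) ''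
      ((E.inverseLift hr).hits (R / (lam - 1)) (deriv τ.onReal) n y (v 1 / v 0) : Set ℕ) := by
  set G := E.inverseLift hr with hG
  have hdeg : 0 < G.degree ^ n := pow_pos G.degree_pos n
  ext ⟨x, ρ⟩
  constructor
  · rintro ⟨h1, h2⟩
    obtain ⟨t, rfl⟩ := QuotientAddGroup.mk_surjective x
    change (skewProduct E τ)^[n] ((t : UnitAddCircle), ρ) = _ at h1
    change v ∈ (jacobianIter E τ n ((t : UnitAddCircle), ρ)).mulVec '' _ at h2
    change ((t : UnitAddCircle), ρ) ∈ _
    have h3 := h1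
    rw [iterate_skewProduct, Prod.mk.injEq] at h3
    obtain ⟨j, hj⟩ := coe_eq_coe_iff_exists_int.1 h3.1
    have hm0 : 0 ≤ j % (G.degree ^ n : ℕ) := Int.emod_nonneg _ (by exact_mod_cast hdeg.ne')
    obtain ⟨m, hm⟩ := Int.eq_ofNat_of_zero_le hm0
    have hm1 : m < G.degree ^ n := by
      have := Int.emod_lt_of_pos j (b := (G.degree ^ n : ℕ)) (by exact_mod_cast hdeg)
      rw [hm] at this
      exact_mod_cast this
    have hj2 : (j : ℝ) = m + (G.degree : ℝ) ^ n * ((j / (G.degree ^ n : ℕ) : ℤ) : ℝ) := by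
      have := Int.emod_add_mul_ediv j (G.degree ^ n : ℕ)
      rw [hm] at this
      exact_mod_cast this.symm
    -- The lift of a preimage is `G^n (y + j)` for some integer `j`; replacing `j` by its residue
    -- `m` changes this point by an integer.
    have ht : (t : UnitAddCircle) = (G.toFun^[n] (y + m) : ℝ) := by
      refine coe_eq_coe_iff_exists_int.2 ⟨j / (G.degree ^ n : ℕ), ?_⟩
      rw [← G.iterate_add_pow_mul, add_assoc, ← hj2, ← hj, E.iterate_inverseLift_lift]
    rw [ht] at h1 h2 ⊢
    rw [iterate_skewProduct, Prod.mk.injEq] at h1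
    rw [jacobianIter_inverseLift, mem_image_cone_iff (InverseLift.weight_pos _ _ _) hv] at h2
    refine ⟨m, G.mem_hits.2 ⟨hm1, h2⟩, ?_⟩
    simp only [Prod.mk.injEq, true_and]
    rw [← h1.2, add_sub_cancel_right]
  · rintro ⟨m, hm, h⟩
    simp only [Prod.mk.injEq] at h
    obtain ⟨rfl, rfl⟩ := h
    rw [Finset.mem_coe, G.mem_hits] at hm
    refine ⟨?_, ?_⟩
    · rw [iterate_skewProduct, E.iterate_lift_inverseLift, sub_add_cancel, Prod.mk.injEq]
      exact ⟨coe_eq_coe_iff_exists_int.2 ⟨m, by simp⟩, rfl⟩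
    · rw [jacobianIter_inverseLift, mem_image_cone_iff (InverseLift.weight_pos _ _ _) hv]
      exact hm.2

namespace InverseLift

theorem injOn_coe_iterate (G : InverseLift) (n : ℕ) (y : ℝ) :
    Set.InjOn (fun m : ℕ => ((G.toFun^[n] (y + m) : ℝ) : UnitAddCircle))
      {m | m < G.degree ^ n} := by
  intro m hm m' hm' h
  obtain ⟨i, hi⟩ := coe_eq_coe_iff_exists_int.1 h
  rw [← G.iterate_add_pow_mul] at hi
  have h2 := G.strictMono.injective.iterate n hi
  rw [add_assoc, add_right_inj] at h2
  have h3 : (m : ℤ) = m' + (G.degree ^ n : ℕ) * i := by exact_mod_cast h2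
  have h4 := congrArg (· % ((G.degree ^ n : ℕ) : ℤ)) h3
  simp only [Int.add_mul_emod_self_left] at h4
  have h5 : m % (G.degree ^ n) = m' % (G.degree ^ n) := by exact_mod_cast h4
  rwa [Nat.mod_eq_of_lt hm, Nat.mod_eq_of_lt hm'] at h5

end InverseLift

theorem encard_preimagesSeeing (E : ExpandingMap r) (hr : r ≠ 0) (τ : CrCircle r) (lam R : ℝ)
    (n : ℕ) (y : ℝ) (σ : UnitAddCircle) {v : Fin 2 → ℝ} (hv : v 0 ≠ 0) :
    (preimagesSeeing E τ lam R n (y, σ) v).encard =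
      ((E.inverseLift hr).hits (R / (lam - 1)) (deriv τ.onReal) n y (v 1 / v 0)).card := by
  rw [preimagesSeeing_eq E hr τ lam R n y σ hv, Set.InjOn.encard_image, Set.encard_coe_eq_coe_finsetCard]
  intro m hm m' hm' h
  rw [Finset.mem_coe, InverseLift.mem_hits] at hm hm'
  exact (E.inverseLift hr).injOn_coe_iterate n y hm.1 hm'.1 (Prod.mk.inj h).1

theorem preimagesSeeing_eq_empty (E : ExpandingMap r) (hr : r ≠ 0) (τ : CrCircle r) (lam R : ℝ)
    (n : ℕ) (z : UnitAddCircle × UnitAddCircle) {v : Fin 2 → ℝ} (hv : v 0 = 0) (hv1 : v 1 ≠ 0) :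
    preimagesSeeing E τ lam R n z v = ∅ := by
  refine Set.eq_empty_of_forall_notMem ?_
  rintro ⟨x, ρ⟩ ⟨-, h2⟩
  obtain ⟨t, rfl⟩ := QuotientAddGroup.mk_surjective x
  change v ∈ (jacobianIter E τ n ((t : UnitAddCircle), ρ)).mulVec '' _ at h2
  rw [← E.iterate_inverseLift_lift hr n t, jacobianIter_inverseLift] at h2
  obtain ⟨c, hc, rfl⟩ := h2
  have hw := ((E.inverseLift hr).weight_pos n (E.lift^[n] t)).ne'
  have hc' : |c 1| ≤ R / (lam - 1) * |c 0| := hc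
  simp only [Matrix.mulVec, dotProduct, Fin.sum_univ_two, Matrix.of_apply, Matrix.cons_val_zero,
      Matrix.cons_val_one, zero_mul, add_zero, one_mul] at hv hv1
  have h0 : c 0 = 0 := (mul_eq_zero.1 hv).resolve_left (inv_ne_zero hw)
  rw [h0, abs_zero, mul_zero] at hc'
  rw [h0, abs_nonpos_iff.1 hc'] at hv1
  simp at hv1

/-- Unit vectors with nonzero first coordinate realise all slopes, and the vertical direction is in
no image of the cone. -/
theorem coneCount_eq (E : ExpandingMap r) (hr : r ≠ 0) (τ : CrCircle r) (lam R : ℝ) (n : ℕ) :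
    coneCount E τ lam R n =
      (E.inverseLift hr).multiplicity (R / (lam - 1)) (deriv τ.onReal) n := by
  apply le_antisymm
  · refine iSup_le fun z => iSup_le fun v => iSup_le fun hv => ?_
    by_cases hv0 : v 0 = 0
    · rw [preimagesSeeing_eq_empty E hr τ lam R n z hv0 (by rintro h; simp [hv0, h] at hv)]
      simp
    · obtain ⟨x, ρ⟩ := z
      obtain ⟨y, rfl⟩ := QuotientAddGroup.mk_surjective x
      refine (encard_preimagesSeeing E hr τ lam R n y ρ hv0).le.trans ?_
      exact_mod_cast InverseLift.card_hits_le_multiplicity _ _ _ _ _ _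
  · obtain ⟨y, s, h⟩ := (E.inverseLift hr).exists_card_hits_eq (R / (lam - 1)) (deriv τ.onReal) n
    have hs : 0 < 1 + s ^ 2 := by positivity
    have hs' := (Real.sqrt_pos.2 hs).ne'
    have hv : (![1 / √(1 + s ^ 2), s / √(1 + s ^ 2)] : Fin 2 → ℝ) 0 ≠ 0 := by
      simpa using hs'
    have hq : (![1 / √(1 + s ^ 2), s / √(1 + s ^ 2)] : Fin 2 → ℝ) 1 /
        (![1 / √(1 + s ^ 2), s / √(1 + s ^ 2)] : Fin 2 → ℝ) 0 = s := by
      simp only [Matrix.cons_val_one, Matrix.cons_val_zero]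
      field_simp
    have := encard_preimagesSeeing E hr τ lam R n y 0 hv
    rw [hq, h] at this
    rw [← this]
    refine le_iSup_of_le ((y : UnitAddCircle), 0) (le_iSup_of_le _ (le_iSup_of_le ?_ le_rfl))
    simp only [Matrix.cons_val_one, Matrix.cons_val_zero]
    rw [div_pow, div_pow, Real.sq_sqrt hs.le]
    field_simp

end PartialCaptivity

/-! ### Uniform bounds, existence of the growth rate, and openness. -/

namespace PartialCaptivity

variable {r : ℕ}

namespace CrCircle

theorem abs_iteratedDeriv_le (τ : CrCircle r) {k : ℕ} (hk : k ≤ r) (t : ℝ) :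
    |iteratedDeriv k τ.onReal t| ≤ ‖τ‖ := by
  have h1 : ‖jet r τ ⟨k, Nat.lt_succ_of_le hk⟩‖ ≤ ‖τ‖ := norm_le_pi_norm (jet r τ) _
  exact ((jet r τ ⟨k, Nat.lt_succ_of_le hk⟩).norm_coe_le_norm (t : UnitAddCircle)).trans h1

theorem abs_deriv_le (hr : r ≠ 0) (τ : CrCircle r) (t : ℝ) : |deriv τ.onReal t| ≤ ‖τ‖ := by
  have := τ.abs_iteratedDeriv_le (k := 1) (by omega) t
  rwa [iteratedDeriv_one] at this

theorem abs_derivative_le (hr : r ≠ 0) (τ : CrCircle r) (x : UnitAddCircle) :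
    |τ.derivative x| ≤ ‖τ‖ := by
  induction x using QuotientAddGroup.induction_on with
  | H t => exact (congrArg abs (τ.derivative_coe t)).le.trans (τ.abs_deriv_le hr t)

theorem supDerivative_le (hr : r ≠ 0) (τ : CrCircle r) : τ.supDerivative ≤ ‖τ‖ :=
  ciSup_le fun x => τ.abs_derivative_le hr x

theorem abs_deriv_le_supDerivative (hr : r ≠ 0) (τ : CrCircle r) (t : ℝ) :
    |deriv τ.onReal t| ≤ τ.supDerivative := by
  rw [← derivative_coe]
  exact le_ciSup (f := fun x => |τ.derivative x|)
    ⟨‖τ‖, by rintro _ ⟨x, rfl⟩; exact τ.abs_derivative_le hr x⟩ (t : UnitAddCircle)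

theorem deriv_add_onReal (hr : r ≠ 0) (τ σ : CrCircle r) (t : ℝ) :
    deriv (τ + σ).onReal t = deriv τ.onReal t + deriv σ.onReal t := by
  have h : ((1 : ℕ) : WithTop ℕ∞) ≤ r := by exact_mod_cast Nat.one_le_iff_ne_zero.2 hr
  rw [onReal_add]
  exact deriv_add (τ.contDiff_onReal.differentiable (by exact_mod_cast hr) t)
    (σ.contDiff_onReal.differentiable (by exact_mod_cast hr) t)

theorem abs_deriv_sub_le (hr : r ≠ 0) (τ σ : CrCircle r) (t : ℝ) :
    |deriv σ.onReal t - deriv τ.onReal t| ≤ ‖σ - τ‖ := by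
  have h := deriv_add_onReal hr τ (σ - τ) t
  rw [add_sub_cancel] at h
  rw [h, add_sub_cancel_left]
  exact abs_deriv_le hr _ t

theorem supDerivative_le_add (hr : r ≠ 0) (τ σ : CrCircle r) :
    σ.supDerivative ≤ τ.supDerivative + ‖σ - τ‖ := by
  refine ciSup_le fun x => ?_
  induction x using QuotientAddGroup.induction_on with
  | H t =>
    refine (congrArg abs (σ.derivative_coe t)).le.trans ?_
    have h1 := abs_deriv_sub_le hr τ σ t
    have h2 := τ.abs_deriv_le_supDerivative hr t
    have h3 := abs_sub_abs_le_abs_sub (deriv σ.onReal t) (deriv τ.onReal t)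
    linarith

theorem abs_deriv_sub_deriv_le (hr : 2 ≤ r) (τ : CrCircle r) (u v : ℝ) :
    |deriv τ.onReal u - deriv τ.onReal v| ≤ ‖τ‖ * |u - v| := by
  have hd : Differentiable ℝ (deriv τ.onReal) := by
    have := τ.contDiff_onReal.differentiable_iteratedDeriv 1 (by exact_mod_cast hr)
    rwa [iteratedDeriv_one] at this
  have := Convex.norm_image_sub_le_of_norm_deriv_le (f := deriv τ.onReal) (C := ‖τ‖)
    (s := Set.univ) (x := v) (y := u) (fun x _ => hd x) (fun x _ => ?_) convex_univ
    (Set.mem_univ _) (Set.mem_univ _)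
  · simpa using this
  · have := τ.abs_iteratedDeriv_le hr x
    rwa [iteratedDeriv_succ, iteratedDeriv_one] at this

end CrCircle

namespace ExpandingMap

variable (E : ExpandingMap r)

theorem continuous_deriv_lift (hr : r ≠ 0) : Continuous (deriv E.lift) :=
  E.contDiff_lift.continuous_deriv (by exact_mod_cast Nat.one_le_iff_ne_zero.2 hr)

/-- The bound is taken to be a natural number so that `Lam ^ n` can serve as the number of grid
points per unit length. -/
theorem exists_inv_le_rate (hr : r ≠ 0) :
    ∃ Lam : ℕ, 2 ≤ Lam ∧ ∀ u, (Lam : ℝ)⁻¹ ≤ (E.inverseLift hr).rate u := by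
  obtain ⟨C, hC⟩ := (E.periodic_deriv_lift.isBounded_of_continuous one_ne_zero
    (E.continuous_deriv_lift hr)).exists_norm_le
  obtain ⟨N, hN⟩ := exists_nat_ge C
  refine ⟨N + 2, by omega, fun u => ?_⟩
  refine inv_anti₀ (E.deriv_lift_pos _) ?_
  have := (Real.le_norm_self _).trans (hC _ (Set.mem_range_self ((E.inverseLift hr).toFun u)))
  push_cast
  exact this.trans (by linarith)

theorem one_le_deriv_lift (t : ℝ) : 1 ≤ deriv E.lift t := by
  obtain ⟨lam, h1, h2⟩ := E.expanding
  exact h1.le.trans (h2 t)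

/-- Since `r ≥ 2`, the periodic function `E''` is bounded; as `E' ≥ 1`, the same constant serves for
the Lipschitz estimate and for the distortion. -/
theorem exists_rate_lipschitz (hr : 2 ≤ r) :
    ∃ B : ℝ, 0 ≤ B ∧
      (∀ u v, |(E.inverseLift (by omega)).rate u - (E.inverseLift (by omega)).rate v| ≤
        B * |u - v|) ∧
      ∀ u v, (E.inverseLift (by omega)).rate u ≤
        (E.inverseLift (by omega)).rate v * Real.exp (B * |u - v|) := by
  have hr0 : r ≠ 0 := by omega
  have hd : Differentiable ℝ (deriv E.lift) := by
    have := E.contDiff_lift.differentiable_iteratedDeriv 1 (by exact_mod_cast hr)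
    rwa [iteratedDeriv_one] at this
  have hc : Continuous (deriv (deriv E.lift)) := by
    have := E.contDiff_lift.continuous_iteratedDeriv 2 (by exact_mod_cast hr)
    rwa [iteratedDeriv_succ, iteratedDeriv_one] at this
  have hp : Function.Periodic (deriv (deriv E.lift)) 1 := by
    intro t
    rw [← deriv_comp_add_const]
    exact congrArg (fun f => deriv f t) (funext E.periodic_deriv_lift)
  obtain ⟨C, hC⟩ := (hp.isBounded_of_continuous one_ne_zero hc).exists_norm_le
  have hC0 : 0 ≤ C := (norm_nonneg _).trans (hC _ (Set.mem_range_self 0))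
  set G := E.inverseLift hr0 with hG
  have hlip : ∀ u v, |deriv E.lift (G.toFun u) - deriv E.lift (G.toFun v)| ≤ C * |u - v| := by
    intro u v
    have h1 := Convex.norm_image_sub_le_of_norm_deriv_le (f := deriv E.lift) (C := C)
      (s := Set.univ) (x := G.toFun v) (y := G.toFun u) (fun x _ => hd x)
      (fun x _ => hC _ (Set.mem_range_self x)) convex_univ (Set.mem_univ _) (Set.mem_univ _)
    have h2 := G.abs_map_sub_le (lam := 1)
      (fun u => inv_anti₀ one_pos (E.one_le_deriv_lift _)) u v
    rw [inv_one, one_mul] at h2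
    exact h1.trans (mul_le_mul_of_nonneg_left h2 hC0)
  refine ⟨C, hC0, fun u v => ?_, fun u v => ?_⟩
  · have ha := E.one_le_deriv_lift (G.toFun u)
    have hb := E.one_le_deriv_lift (G.toFun v)
    have h := hlip v u
    rw [abs_sub_comm v u] at h
    change |(deriv E.lift (G.toFun u))⁻¹ - (deriv E.lift (G.toFun v))⁻¹| ≤ _
    have e : (deriv E.lift (G.toFun u))⁻¹ - (deriv E.lift (G.toFun v))⁻¹ =
        (deriv E.lift (G.toFun v) - deriv E.lift (G.toFun u)) /
          (deriv E.lift (G.toFun u) * deriv E.lift (G.toFun v)) := by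
      field_simp
    rw [e, abs_div]
    refine (div_le_self (abs_nonneg _) ?_).trans h
    rw [abs_of_pos (by positivity)]
    nlinarith
  · have ha := E.one_le_deriv_lift (G.toFun u)
    have hb := E.one_le_deriv_lift (G.toFun v)
    have h := (le_abs_self _).trans (hlip v u)
    rw [abs_sub_comm v u] at h
    change (deriv E.lift (G.toFun u))⁻¹ ≤ (deriv E.lift (G.toFun v))⁻¹ * _
    have h1 := Real.add_one_le_exp (C * |u - v|)
    have h2 : 0 ≤ C * |u - v| := by positivity
    rw [inv_mul_eq_div, le_div_iff₀ (by linarith), inv_mul_eq_div, div_le_iff₀ (by linarith)]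
    nlinarith [Real.exp_pos (C * |u - v|)]

end ExpandingMap

/-- The constants that are admitted in the definition of the growth rate. -/
structure Admissible (E : ExpandingMap r) (τ : CrCircle r) (lam R : ℝ) : Prop where
  one_lt : 1 < lam
  le_derivative : ∀ x : UnitAddCircle, lam ≤ E.derivative x
  lt : τ.supDerivative < R

theorem ExpandingMap.exists_le_derivative (E : ExpandingMap r) :
    ∃ lam : ℝ, 1 < lam ∧ ∀ x : UnitAddCircle, lam ≤ E.derivative x := by
  obtain ⟨lam, h1, h2⟩ := E.expanding
  refine ⟨lam, h1, fun x => ?_⟩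
  induction x using QuotientAddGroup.induction_on with
  | H t => exact h2 t

namespace Admissible

variable {E : ExpandingMap r} {τ : CrCircle r} {lam R : ℝ}

theorem rate_le (h : Admissible E τ lam R) (hr : r ≠ 0) (u : ℝ) :
    (E.inverseLift hr).rate u ≤ lam⁻¹ :=
  E.rate_inverseLift_le hr (zero_lt_one.trans h.one_lt) h.le_derivative u

theorem abs_deriv_le (h : Admissible E τ lam R) (hr : r ≠ 0) (u : ℝ) : |deriv τ.onReal u| ≤ R :=
  (τ.abs_deriv_le_supDerivative hr u).trans h.lt.le

theorem R_pos (h : Admissible E τ lam R) (hr : r ≠ 0) : 0 < R :=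
  ((abs_nonneg _).trans (τ.abs_deriv_le_supDerivative hr 0)).trans_lt h.lt

theorem cone_nonneg (h : Admissible E τ lam R) (hr : r ≠ 0) : 0 ≤ R / (lam - 1) :=
  div_nonneg (h.R_pos hr).le (by linarith [h.one_lt])

/-- The logarithm of the multiplicity of the images of the cone. -/
noncomputable def logCount (E : ExpandingMap r) (hr : r ≠ 0) (τ : CrCircle r) (lam R : ℝ) (n : ℕ) :
    ℝ :=
  Real.log ((E.inverseLift hr).multiplicity (R / (lam - 1)) (deriv τ.onReal) n)

theorem one_le_count (h : Admissible E τ lam R) (hr : r ≠ 0) (n : ℕ) :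
    (1 : ℝ) ≤ (E.inverseLift hr).multiplicity (R / (lam - 1)) (deriv τ.onReal) n := by
  exact_mod_cast InverseLift.one_le_multiplicity _ (h.cone_nonneg hr) _ _

theorem logCount_nonneg (h : Admissible E τ lam R) (hr : r ≠ 0) (n : ℕ) :
    0 ≤ logCount E hr τ lam R n :=
  Real.log_nonneg (h.one_le_count hr n)

theorem subadditive (h : Admissible E τ lam R) (hr : r ≠ 0) :
    Subadditive (logCount E hr τ lam R) := by
  intro m n
  have h1 := (E.inverseLift hr).multiplicity_add_le τ.periodic_deriv_onReal (k := m) (n := n)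
    (ϑ := R / (lam - 1)) ((E.inverseLift hr).abs_slope_add_le h.one_lt (h.rate_le hr)
      (h.abs_deriv_le hr) n)
  have hm := h.one_le_count hr m
  have hn := h.one_le_count hr n
  rw [logCount, logCount, logCount, add_comm (Real.log _), ← Real.log_mul (by linarith) (by linarith)]
  refine Real.log_le_log (by linarith [h.one_le_count hr (m + n)]) ?_
  exact_mod_cast h1

theorem bddBelow (h : Admissible E τ lam R) (hr : r ≠ 0) :
    BddBelow (Set.range fun n : ℕ => logCount E hr τ lam R n / n) :=
  ⟨0, by rintro _ ⟨n, rfl⟩; exact div_nonneg (h.logCount_nonneg hr n) n.cast_nonneg⟩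

/-- Slopes are bounded by `‖τ'‖ / (lam - 1)`, strictly less than `R / (lam - 1)`, so after enough
steps `k` any cone is carried into the cone of `(lam, R)`. These steps cost a factor `degree ^ k`,
which does not affect the exponential rate. -/
theorem lim_le_lim (h : Admissible E τ lam R) {lam' R' : ℝ} (h' : Admissible E τ lam' R')
    (hr : r ≠ 0) : (h'.subadditive hr).lim ≤ (h.subadditive hr).lim := by
  set G := E.inverseLift hr
  have hl' : 0 < lam' - 1 := by linarith [h'.one_lt]
  have hl : 0 < lam - 1 := by linarith [h.one_lt]
  obtain ⟨k, hk⟩ : ∃ k : ℕ, R' / (lam' - 1) * lam'⁻¹ ^ k ≤ (R - τ.supDerivative) / (lam - 1) := by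
    have ht : Tendsto (fun k : ℕ => R' / (lam' - 1) * lam'⁻¹ ^ k) atTop (𝓝 0) := by
      have := (tendsto_pow_atTop_nhds_zero_of_lt_one (r := lam'⁻¹)
        (inv_nonneg.2 (by linarith)) (inv_lt_one_of_one_lt₀ h'.one_lt)).const_mul (R' / (lam' - 1))
      simpa using this
    have hpos : 0 < (R - τ.supDerivative) / (lam - 1) := div_pos (by linarith [h.lt]) hl
    exact (ht.eventually (eventually_le_nhds hpos)).exists
  have hinv : ∀ u, |G.slope (deriv τ.onReal) k u| + R' / (lam' - 1) * G.weight k u ≤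
      R / (lam - 1) := by
    intro u
    have h1 := G.abs_slope_le h.one_lt (h.rate_le hr) (τ.abs_deriv_le_supDerivative hr) k u
    have h2 := mul_le_mul_of_nonneg_left (G.weight_le h'.one_lt (h'.rate_le hr) k u)
      (h'.cone_nonneg hr)
    have e : R / (lam - 1) = τ.supDerivative / (lam - 1) + (R - τ.supDerivative) / (lam - 1) := by
      ring
    rw [e]
    linarith
  have hle : ∀ n, logCount E hr τ lam' R' (n + k) ≤
      k * Real.log G.degree + logCount E hr τ lam R n := by
    intro n
    have h1 := G.multiplicity_add_le τ.periodic_deriv_onReal (k := n) (n := k) hinv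
    have h2 := Nat.mul_le_mul_right (G.multiplicity (R / (lam - 1)) (deriv τ.onReal) n)
      (G.multiplicity_le_pow (R' / (lam' - 1)) (deriv τ.onReal) k)
    have h3 := h.one_le_count hr n
    have hd : (G.degree : ℝ) ≠ 0 := by exact_mod_cast G.degree_pos.ne'
    rw [logCount, logCount, ← Real.log_pow, ← Real.log_mul (pow_ne_zero _ hd) (by linarith)]
    refine Real.log_le_log (by linarith [h'.one_le_count hr (n + k)]) ?_
    exact_mod_cast h1.trans h2
  have t1 := (tendsto_add_atTop_iff_nat k).2 ((h'.subadditive hr).tendsto_lim (h'.bddBelow hr))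
  have t2 : Tendsto (fun n : ℕ => (k * Real.log G.degree) / (n : ℝ) + logCount E hr τ lam R n / n)
      atTop (𝓝 (0 + (h.subadditive hr).lim)) :=
    (tendsto_const_div_atTop_nhds_zero_nat _).add
      ((h.subadditive hr).tendsto_lim (h.bddBelow hr))
  rw [zero_add] at t2
  refine le_of_tendsto_of_tendsto t1 t2 ?_
  filter_upwards [eventually_gt_atTop 0] with n hn
  rw [← add_div]
  have hn' : (0 : ℝ) < n := by exact_mod_cast hn
  have : (n : ℝ) ≤ (n + k : ℕ) := by push_cast; linarith [(k.cast_nonneg : (0 : ℝ) ≤ k)]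
  exact (div_le_div_of_nonneg_left (h'.logCount_nonneg hr _) hn' this).trans
    (div_le_div_of_nonneg_right (hle n) hn'.le)

theorem coneCount_rpow (h : Admissible E τ lam R) (hr : r ≠ 0) (n : ℕ) :
    ((coneCount E τ lam R n : ℕ∞) : ℝ≥0∞) ^ ((1 : ℝ) / (n : ℝ)) =
      ENNReal.ofReal (Real.exp (logCount E hr τ lam R n / n)) := by
  have h1 := h.one_le_count hr n
  have h0 : (0 : ℝ) < (E.inverseLift hr).multiplicity (R / (lam - 1)) (deriv τ.onReal) n := by
    linarith
  rw [coneCount_eq E hr, ENat.toENNReal_coe, ← ENNReal.ofReal_natCast,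
    ENNReal.ofReal_rpow_of_pos h0, Real.rpow_def_of_pos h0, logCount, mul_one_div]

theorem tendsto_coneCount (h : Admissible E τ lam R) (hr : r ≠ 0) :
    Tendsto (fun n : ℕ => ((coneCount E τ lam R n : ℕ∞) : ℝ≥0∞) ^ ((1 : ℝ) / (n : ℝ)))
      atTop (𝓝 (ENNReal.ofReal (Real.exp (h.subadditive hr).lim))) := by
  simp only [h.coneCount_rpow hr]
  exact (ENNReal.continuous_ofReal.comp Real.continuous_exp).continuousAt.tendsto.comp
    ((h.subadditive hr).tendsto_lim (h.bddBelow hr))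

theorem isGrowthRate (h : Admissible E τ lam R) (hr : r ≠ 0) :
    IsGrowthRate E τ (ENNReal.ofReal (Real.exp (h.subadditive hr).lim)) := by
  intro lam' R' h1 h2 h3
  have h' : Admissible E τ lam' R' := ⟨h1, h2, h3⟩
  rw [le_antisymm (h'.lim_le_lim h hr) (h.lim_le_lim h' hr)]
  exact h'.tendsto_coneCount hr

theorem lim_nonneg (h : Admissible E τ lam R) (hr : r ≠ 0) : 0 ≤ (h.subadditive hr).lim :=
  ge_of_tendsto' ((h.subadditive hr).tendsto_lim (h.bddBelow hr)) fun n =>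
    div_nonneg (h.logCount_nonneg hr n) n.cast_nonneg

/-- The limit of a subadditive sequence divided by `n` is its infimum, so a single `n` suffices. -/
theorem exp_lim_lt (h : Admissible E τ lam R) (hr : r ≠ 0) {ϱ : ℝ} (hϱ : 0 < ϱ) {n : ℕ}
    (hn : n ≠ 0)
    (hlt : ((E.inverseLift hr).multiplicity (R / (lam - 1)) (deriv τ.onReal) n : ℝ) < ϱ ^ n) :
    Real.exp (h.subadditive hr).lim < ϱ := by
  rw [← Real.lt_log_iff_exp_lt hϱ]
  refine ((h.subadditive hr).lim_le_div (h.bddBelow hr) hn).trans_lt ?_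
  have hn' : (0 : ℝ) < n := by exact_mod_cast Nat.pos_of_ne_zero hn
  rw [div_lt_iff₀ hn', mul_comm, ← Real.log_pow]
  exact Real.log_lt_log (by linarith [h.one_le_count hr n]) hlt

end Admissible

/-- The functions for which the growth rate is less than `ϱ`. -/
def growthRateLT (E : ExpandingMap r) (hr : r ≠ 0) (ϱ : ℝ) : Set (CrCircle r) :=
  {τ | ∃ lam R : ℝ, Admissible E τ lam R ∧ ∃ n : ℕ, n ≠ 0 ∧
    ((E.inverseLift hr).multiplicity (R / (lam - 1)) (deriv τ.onReal) n : ℝ) < ϱ ^ n}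

theorem exists_isGrowthRate_lt {E : ExpandingMap r} {hr : r ≠ 0} {ϱ : ℝ} (hϱ : 0 < ϱ)
    {τ : CrCircle r} (hτ : τ ∈ growthRateLT E hr ϱ) :
    ∃ L : ℝ≥0∞, IsGrowthRate E τ L ∧ L < ENNReal.ofReal ϱ := by
  obtain ⟨lam, R, h, n, hn, hlt⟩ := hτ
  exact ⟨_, h.isGrowthRate hr, (ENNReal.ofReal_lt_ofReal_iff hϱ).2 (h.exp_lim_lt hr hϱ hn hlt)⟩

/-- The cone of an intermediate `R'` leaves a margin `(R - R') / (lam - 1) * weight`. As `n` is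
fixed, the weight is at least `Lam⁻¹ ^ n`, and the margin absorbs the change of slope caused by a
small perturbation of `τ`. -/
theorem isOpen_growthRateLT (E : ExpandingMap r) (hr : r ≠ 0) (ϱ : ℝ) :
    IsOpen (growthRateLT E hr ϱ) := by
  rw [Metric.isOpen_iff]
  rintro τ ⟨lam, R, h, n, hn, hlt⟩
  set G := E.inverseLift hr with hG
  obtain ⟨Lam, hLam, hrate⟩ := E.exists_inv_le_rate hr
  have hLam0 : (0 : ℝ) < Lam := by exact_mod_cast (by omega : 0 < Lam)
  have hl : 0 < lam - 1 := by linarith [h.one_lt]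
  set R' := (τ.supDerivative + R) / 2 with hR'
  have hR1 : τ.supDerivative < R' := by linarith [h.lt]
  have hR2 : R' < R := by linarith [h.lt]
  have hw0 : 0 < (Lam : ℝ)⁻¹ ^ n := by positivity
  -- The first bound keeps `R'` admissible for `σ`; the second makes every hit for `σ` and `R'` a
  -- hit for `τ` and `R`.
  refine ⟨min (R' - τ.supDerivative) ((R - R') * (Lam : ℝ)⁻¹ ^ n),
    lt_min (by linarith) (mul_pos (by linarith) hw0), fun σ hσ => ?_⟩
  rw [Metric.mem_ball, dist_eq_norm, lt_min_iff] at hσ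
  refine ⟨lam, R', ⟨h.one_lt, h.le_derivative, ?_⟩, n, hn, lt_of_le_of_lt ?_ hlt⟩
  · linarith [CrCircle.supDerivative_le_add hr τ σ]
  · refine Nat.cast_le.2 (G.multiplicity_le fun y s => le_trans (Finset.card_le_card ?_)
      (G.card_hits_le_multiplicity _ _ n y s))
    intro m hm
    rw [G.mem_hits] at hm ⊢
    refine ⟨hm.1, ?_⟩
    have h1 := G.abs_slope_sub_le_of_forall h.one_lt (h.rate_le hr)
      (fun u => CrCircle.abs_deriv_sub_le hr τ σ u) n (y + m)
    have h2 : ‖σ - τ‖ / (lam - 1) ≤ (R - R') / (lam - 1) * G.weight n (y + m) := by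
      rw [div_mul_eq_mul_div]
      refine div_le_div_of_nonneg_right (hσ.2.le.trans ?_) hl.le
      exact mul_le_mul_of_nonneg_left (G.le_weight hLam0 hrate n _) (by linarith)
    have h3 := abs_sub_le (G.slope (deriv τ.onReal) n (y + m))
      (G.slope (deriv σ.onReal) n (y + m)) s
    rw [abs_sub_comm (G.slope (deriv τ.onReal) n (y + m)) (G.slope (deriv σ.onReal) n _)] at h3
    have e : R / (lam - 1) * G.weight n (y + m) = (R - R') / (lam - 1) * G.weight n (y + m) +
        R' / (lam - 1) * G.weight n (y + m) := by ring
    rw [e]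
    linarith [hm.2]

theorem partiallyCaptive_of_forall_mem {E : ExpandingMap r} {hr : r ≠ 0} {τ : CrCircle r}
    (hτ : ∀ k : ℕ, τ ∈ growthRateLT E hr (1 + 1 / (k + 1))) : PartiallyCaptive E τ := by
  obtain ⟨lam, R, h, -⟩ := hτ 0
  have h0 : Real.exp (h.subadditive hr).lim = 1 := by
    apply le_antisymm
    · refine ge_of_tendsto' (x := atTop) (f := fun k : ℕ => (1 : ℝ) + 1 / (k + 1)) ?_ fun k => ?_
      · simpa using tendsto_one_div_add_atTop_nhds_zero_nat.const_add (1 : ℝ)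
      · obtain ⟨lam', R', h', n, hn, hlt⟩ := hτ k
        have h1 := h'.exp_lim_lt hr (by positivity) hn hlt
        -- The constants `lam'`, `R'` vary with `k`, but the limit does not depend on them.
        rw [le_antisymm (h'.lim_le_lim h hr) (h.lim_le_lim h' hr)]
        exact h1.le
    · exact Real.one_le_exp (h.lim_nonneg hr)
  have := h.isGrowthRate hr
  rwa [h0, ENNReal.ofReal_one] at this

end PartialCaptivity

/-! ### Perturbations whose derivatives are bumps. -/

namespace PartialCaptivity

variable {r : ℕ}

/-- The primitive is periodic exactly because the mean vanishes; this is why the bumps must be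
slightly negative somewhere. -/
theorem exists_deriv_onReal_eq (r : ℕ) {g : ℝ → ℝ} (hg : ContDiff ℝ (⊤ : ℕ∞) g)
    (hp : Function.Periodic g 1) (h0 : ∫ t in (0 : ℝ)..1, g t = 0) :
    ∃ φ : CrCircle r, deriv φ.onReal = g := by
  set f : ℝ → ℝ := fun x => ∫ t in (0 : ℝ)..x, g t with hf
  have hint : ∀ a b : ℝ, IntervalIntegrable g MeasureTheory.volume a b :=
    fun a b => hg.continuous.intervalIntegrable a b
  have hd : ∀ x, HasDerivAt f (g x) x := fun x => hg.continuous.integral_hasStrictDerivAt 0 x |>.hasDerivAt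
  have hfp : Function.Periodic f 1 := by
    intro x
    have h1 := intervalIntegral.integral_add_adjacent_intervals (hint 0 x) (hint x (x + 1))
    have h2 := hp.intervalIntegral_add_eq x 0
    rw [zero_add, h0] at h2
    rw [h2, add_zero] at h1
    exact h1.symm
  have hdf : deriv f = g := funext fun x => (hd x).deriv
  have hfc : ContDiff ℝ (⊤ : ℕ∞) f := by
    rw [contDiff_infty_iff_deriv, hdf]
    exact ⟨fun x => (hd x).differentiableAt, hg⟩
  refine ⟨⟨hfp.lift, ?_⟩, ?_⟩
  · change ContDiff ℝ r f
    exact hfc.of_le (by exact_mod_cast le_top)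
  · exact hdf

theorem tendsto_integral_cos_sq_pow :
    Tendsto (fun n : ℕ => ∫ t in (0 : ℝ)..1, (Real.cos (Real.pi * t) ^ 2) ^ n) atTop (𝓝 0) := by
  rw [show 𝓝 (0 : ℝ) = 𝓝 (∫ _t in (0 : ℝ)..1, (0 : ℝ)) by simp]
  refine intervalIntegral.tendsto_integral_filter_of_dominated_convergence
    (l := atTop) (F := fun (n : ℕ) (t : ℝ) => (Real.cos (Real.pi * t) ^ 2) ^ n) (fun _ => 1)
    (Eventually.of_forall fun n => ?_) (Eventually.of_forall fun n => ?_) ?_ ?_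
  · exact Continuous.aestronglyMeasurable (by fun_prop)
  · refine Eventually.of_forall fun t _ => ?_
    rw [Real.norm_eq_abs, abs_of_nonneg (by positivity)]
    exact pow_le_one₀ (sq_nonneg _) (Real.cos_sq_le_one _)
  · exact intervalIntegrable_const
  · have h1 : ∀ᵐ t : ℝ ∂MeasureTheory.volume, t ≠ 1 := by
      simp [MeasureTheory.ae_iff, MeasureTheory.measure_singleton]
    filter_upwards [h1] with t ht ht'
    rw [Set.uIoc_of_le zero_le_one] at ht'
    refine tendsto_pow_atTop_nhds_zero_of_lt_one (sq_nonneg _) ?_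
    have hs : 0 < Real.sin (Real.pi * t) :=
      Real.sin_pos_of_pos_of_lt_pi (mul_pos Real.pi_pos ht'.1) (by
        have := lt_of_le_of_ne ht'.2 ht
        nlinarith [Real.pi_pos])
    nlinarith [Real.sin_sq_add_cos_sq (Real.pi * t)]

theorem cos_pi_sub_int_sq (x : ℝ) (i : ℤ) :
    Real.cos (Real.pi * (x - i)) ^ 2 = Real.cos (Real.pi * x) ^ 2 := by
  rw [mul_sub, mul_comm Real.pi (i : ℝ), Real.cos_sub_int_mul_pi, mul_pow]
  rcases Int.even_or_odd i with h | h
  · rw [h.neg_one_zpow, one_pow, one_mul]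
  · rw [h.neg_one_zpow, neg_one_sq, one_mul]

theorem cos_pi_sq_le {x ρ : ℝ} (hρ : 0 ≤ ρ) (hx : ∀ i : ℤ, ρ ≤ |x - i|) :
    Real.cos (Real.pi * x) ^ 2 ≤ Real.cos (Real.pi * ρ) ^ 2 := by
  have h1 := hx (round x)
  have h2 := abs_sub_round x
  rw [← cos_pi_sub_int_sq x (round x), ← Real.cos_abs, abs_mul, abs_of_pos Real.pi_pos]
  have hp := Real.pi_pos
  have h3 : Real.cos (Real.pi * |x - round x|) ≤ Real.cos (Real.pi * ρ) :=
    Real.cos_le_cos_of_nonneg_of_le_pi (by positivity) (by nlinarith) (by gcongr)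
  have h4 : 0 ≤ Real.cos (Real.pi * |x - round x|) :=
    Real.cos_nonneg_of_neg_pi_div_two_le_of_le (by nlinarith [abs_nonneg (x - round x)])
      (by nlinarith)
  exact pow_le_pow_left₀ h4 h3 2

/-- A finite family of functions whose derivatives are bumps that cover the circle. -/
theorem exists_bumps (r : ℕ) {ρ η : ℝ} (hρ : 0 < ρ) (hρ1 : ρ ≤ 1) (hη : 0 < η) (hη1 : η ≤ 1 / 4) :
    ∃ D : ℕ, ∃ φ : Fin D → CrCircle r,
      (∀ c u, -η ≤ deriv (φ c).onReal u ∧ deriv (φ c).onReal u ≤ 1) ∧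
      ∀ x, ∃ c, 1 / 4 ≤ deriv (φ c).onReal x ∧
        ∀ x', (∀ i : ℤ, ρ ≤ |x' - x - i|) → deriv (φ c).onReal x' ≤ η := by
  have hp := Real.pi_pos
  have hc1 : Real.cos (Real.pi * (ρ / 2)) ^ 2 < 1 := by
    have hs : 0 < Real.sin (Real.pi * (ρ / 2)) :=
      Real.sin_pos_of_pos_of_lt_pi (by positivity) (by nlinarith)
    nlinarith [Real.sin_sq_add_cos_sq (Real.pi * (ρ / 2))]
  -- A high power of `cos²` has mean at most `η` and is at most `η` outside the `ρ /
  -- 2`-neighbourhood of the integers.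
  obtain ⟨n, hn1, hn2⟩ := ((tendsto_integral_cos_sq_pow.eventually (eventually_le_nhds hη)).and
    ((tendsto_pow_atTop_nhds_zero_of_lt_one (sq_nonneg _) hc1).eventually
      (eventually_le_nhds hη))).exists
  set b : ℝ → ℝ := fun x => (Real.cos (Real.pi * x) ^ 2) ^ n with hb
  have hbc : ContDiff ℝ (⊤ : ℕ∞) b := by
    rw [hb]; exact ((Real.contDiff_cos.comp (contDiff_const.mul contDiff_id)).pow 2).pow n
  have hbint : ∀ (x : ℝ) (i : ℤ), b (x - i) = b x := fun x i => by
    simp only [hb, cos_pi_sub_int_sq]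
  have hbp : Function.Periodic b 1 := by
    intro x
    have := hbint (x + 1) 1
    push_cast at this
    rw [add_sub_cancel_right] at this
    exact this.symm
  have hb0 : ∀ x, 0 ≤ b x := fun x => by simp only [hb]; positivity
  have hb1 : ∀ x, b x ≤ 1 := fun x => pow_le_one₀ (sq_nonneg _) (Real.cos_sq_le_one _)
  set μ : ℝ := ∫ t in (0 : ℝ)..1, b t with hμ
  have hμ0 : 0 ≤ μ := intervalIntegral.integral_nonneg zero_le_one fun t _ => hb0 t
  obtain ⟨δ, hδ, hδb⟩ : ∃ δ > 0, ∀ x : ℝ, |x| ≤ δ → 1 / 2 ≤ b x := by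
    have hb00 : 1 / 2 < b 0 := by simp only [hb]; simp; norm_num
    have := hbc.continuous.continuousAt.eventually (eventually_ge_nhds hb00)
    obtain ⟨δ, hδ, h⟩ := Metric.eventually_nhds_iff.1 this
    refine ⟨δ / 2, by positivity, fun x hx => h ?_⟩
    rw [dist_zero_right, Real.norm_eq_abs]
    linarith
  -- The mesh of the centres is less than `δ`, so that some translate is at least `1 / 2` at `x`,
  -- and less than `ρ / 2`, so that a point `ρ`-far from `x` is `ρ / 2`-far from the centre.
  obtain ⟨D, hD⟩ := exists_nat_one_div_lt (lt_min hδ (half_pos hρ))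
  have hDpos : (0 : ℝ) < (D : ℝ) + 1 := by positivity
  have hφ : ∀ c : Fin (D + 1), ∃ φ : CrCircle r,
      deriv φ.onReal = fun x => b (x - (c : ℕ) / ((D : ℝ) + 1)) - μ := by
    intro c
    have hsub : Function.Periodic (fun x => b (x - (c : ℕ) / ((D : ℝ) + 1))) 1 := by
      intro x
      simp only
      rw [add_sub_right_comm, hbp]
    refine exists_deriv_onReal_eq r ?_ ?_ ?_
    · exact (hbc.comp (contDiff_id.sub contDiff_const)).sub contDiff_const
    · intro x
      simp only
      rw [add_sub_right_comm, hbp]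
    · rw [intervalIntegral.integral_sub]
      · rw [intervalIntegral.integral_comp_sub_right (fun x => b x),
          show (1 : ℝ) - (c : ℕ) / ((D : ℝ) + 1) = 0 - (c : ℕ) / ((D : ℝ) + 1) + 1 by ring,
          hbp.intervalIntegral_add_eq _ 0, zero_add]
        simp [hμ]
      · exact (hbc.continuous.comp (continuous_id.sub continuous_const)).intervalIntegrable _ _
      · exact intervalIntegrable_const
  choose φ hφ using hφ
  refine ⟨D + 1, φ, fun c u => ?_, fun x => ?_⟩
  · rw [hφ]
    simp only
    exact ⟨by linarith [hb0 (u - (c : ℕ) / ((D : ℝ) + 1))],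
      by linarith [hb1 (u - (c : ℕ) / ((D : ℝ) + 1))]⟩
  · have hf0 := Int.fract_nonneg x
    have hf1 := Int.fract_lt_one x
    have hk : ⌊Int.fract x * ((D : ℝ) + 1)⌋₊ < D + 1 := by
      rw [Nat.floor_lt (by positivity)]
      push_cast
      nlinarith
    set k := ⌊Int.fract x * ((D : ℝ) + 1)⌋₊
    have hk1 : (k : ℝ) ≤ Int.fract x * ((D : ℝ) + 1) := Nat.floor_le (by positivity)
    have hk2 : Int.fract x * ((D : ℝ) + 1) < k + 1 := Nat.lt_floor_add_one _
    have hclose : |Int.fract x - k / ((D : ℝ) + 1)| ≤ 1 / ((D : ℝ) + 1) := by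
      rw [abs_le]
      constructor
      · rw [neg_le_sub_iff_le_add, div_le_iff₀ hDpos, add_mul, one_div, inv_mul_cancel₀ hDpos.ne']
        linarith
      · rw [sub_le_iff_le_add, ← add_div, le_div_iff₀ hDpos]
        linarith
    refine ⟨⟨k, hk⟩, ?_, fun x' hx' => ?_⟩
    · rw [hφ]
      simp only
      have h1 := hδb _ (hclose.trans (hD.le.trans (min_le_left _ _)))
      rw [← Int.self_sub_floor, sub_right_comm, hbint] at h1
      -- The mean `μ` is at most `η ≤ 1 / 4`, which leaves `1 / 2 - μ ≥ 1 / 4`.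
      linarith
    · rw [hφ]
      simp only
      have : b (x' - k / ((D : ℝ) + 1)) ≤ (Real.cos (Real.pi * (ρ / 2)) ^ 2) ^ n := by
        refine pow_le_pow_left₀ (sq_nonneg _) (cos_pi_sq_le (by positivity) fun i => ?_) n
        have h1 := hx' (i - ⌊x⌋)
        have h2 := hclose.trans (hD.le.trans (min_le_right _ _))
        have h3 := abs_sub_abs_le_abs_sub (x' - x - ((i - ⌊x⌋ : ℤ) : ℝ))
          (-(Int.fract x - k / ((D : ℝ) + 1)))
        rw [abs_neg] at h3
        have e : x' - x - ((i - ⌊x⌋ : ℤ) : ℝ) - -(Int.fract x - k / ((D : ℝ) + 1)) =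
            x' - k / ((D : ℝ) + 1) - i := by
          push_cast
          rw [← Int.self_sub_floor]; ring
        rw [e] at h3
        linarith
      linarith

end PartialCaptivity

/-! ### Nearly diagonal determinants and volumes of parameter sets. -/

namespace PartialCaptivity

/-- A lower bound for the determinant of a nearly diagonal matrix. -/
theorem sub_le_abs_det {p : ℕ} (M : Matrix (Fin p) (Fin p) ℝ) {d η A : ℝ} (hd : 0 ≤ d)
    (hη : 0 ≤ η) (hA : 1 ≤ A) (hdiag : ∀ i, d ≤ M i i) (hle : ∀ i j, |M i j| ≤ A)
    (hoff : ∀ i j, i ≠ j → |M i j| ≤ η) :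
    d ^ p - p.factorial * (η * A ^ p) ≤ |M.det| := by
  classical
  rw [Matrix.det_apply, ← Finset.add_sum_erase _ _ (Finset.mem_univ (1 : Equiv.Perm (Fin p)))]
  have h1 : d ^ p ≤ |∏ i, M i i| := by
    rw [abs_of_nonneg (Finset.prod_nonneg fun i _ => hd.trans (hdiag i))]
    calc d ^ p = ∏ _i : Fin p, d := by simp
      _ ≤ _ := Finset.prod_le_prod (fun _ _ => hd) fun i _ => hdiag i
  have h2 : |∑ σ ∈ Finset.univ.erase (1 : Equiv.Perm (Fin p)),
      Equiv.Perm.sign σ • ∏ i, M (σ i) i| ≤ p.factorial * (η * A ^ p) := by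
    refine (Finset.abs_sum_le_sum_abs _ _).trans ?_
    have hb : ∀ σ ∈ Finset.univ.erase (1 : Equiv.Perm (Fin p)),
        |Equiv.Perm.sign σ • ∏ i, M (σ i) i| ≤ η * A ^ p := by
      intro σ hσ
      have hσ1 : σ ≠ 1 := (Finset.mem_erase.1 hσ).1
      -- A permutation other than the identity meets an off-diagonal entry, which contributes the
      -- factor `η`.
      obtain ⟨i, hi⟩ : ∃ i, σ i ≠ i := by
        by_contra! hcon
        exact hσ1 (Equiv.ext hcon)
      have e : |Equiv.Perm.sign σ • ∏ i, M (σ i) i| = ∏ i, |M (σ i) i| := by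
        rw [← Finset.abs_prod]
        rcases Int.units_eq_one_or (Equiv.Perm.sign σ) with h | h <;> rw [h] <;> simp
      rw [e, ← Finset.mul_prod_erase _ _ (Finset.mem_univ i)]
      have h3 : ∏ x ∈ Finset.univ.erase i, |M (σ x) x| ≤ A ^ p := by
        calc _ ≤ ∏ _x ∈ Finset.univ.erase i, A :=
              Finset.prod_le_prod (fun _ _ => abs_nonneg _) fun _ _ => hle _ _
          _ = A ^ (Finset.univ.erase i).card := by simp
          _ ≤ A ^ p := pow_le_pow_right₀ hA ((Finset.card_le_univ _).trans (by simp))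
      exact mul_le_mul (hoff _ _ hi) h3 (Finset.prod_nonneg fun _ _ => abs_nonneg _) hη
    refine (Finset.sum_le_card_nsmul _ _ _ hb).trans ?_
    rw [nsmul_eq_mul]
    have hc : ((Finset.univ.erase (1 : Equiv.Perm (Fin p))).card : ℝ) ≤ p.factorial := by
      have := Finset.card_le_univ (Finset.univ.erase (1 : Equiv.Perm (Fin p)))
      rw [Fintype.card_perm, Fintype.card_fin] at this
      exact_mod_cast this
    have : 0 ≤ η * A ^ p := by positivity
    gcongr
  have h3 := abs_sub_abs_le_abs_sub (∏ i, M i i)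
    (-∑ σ ∈ Finset.univ.erase (1 : Equiv.Perm (Fin p)), Equiv.Perm.sign σ • ∏ i, M (σ i) i)
  rw [abs_neg, sub_neg_eq_add] at h3
  simp only [Equiv.Perm.sign_one, one_smul, Equiv.Perm.coe_one, id]
  linarith

open MeasureTheory in
/-- The volume of the parameters of a cube for which `p` affine functions are small, when a minor
of their matrix is bounded from below. -/
theorem volume_affine_box_le {ι : Type*} [Fintype ι] {p : ℕ} (c : Fin p → ι)
    (hc : Function.Injective c) (A : Fin p → ι → ℝ) (b w : Fin p → ℝ) (hw : ∀ j, 0 ≤ w j)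
    {κ ε : ℝ} (hκ : 0 < κ) (hε : 0 < ε)
    (hdet : κ ≤ |(Matrix.of fun i j => A i (c j)).det|) :
    volume {t : ι → ℝ | (∀ i, |t i| ≤ ε) ∧ ∀ j, |b j + ∑ i, t i * A j i| ≤ w j} ≤
      ENNReal.ofReal (κ⁻¹ * (2 * ε) ^ Fintype.card ι * ∏ j, (w j / ε)) := by
  classical
  set P : ι → Prop := fun i => ∃ j, c j = i with hP
  set e : Fin p ≃ {i // P i} := Equiv.ofInjective c hc with he
  have hec : ∀ j, ((e j : {i // P i}) : ι) = c j := fun j => rfl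
  -- The `p` rows are completed to a square matrix by rows of the identity at the indices outside
  -- the range of `c`. The result is block triangular, its determinant is the given minor, and it
  -- maps the set into a box.
  set M : Matrix ι ι ℝ := Matrix.of fun i k =>
    if h : P i then A (e.symm ⟨i, h⟩) k else if i = k then 1 else 0 with hM
  have hMc : ∀ j k, M (c j) k = A j k := by
    intro j k
    have hPc : P (c j) := ⟨j, rfl⟩
    have h1 : e.symm ⟨c j, hPc⟩ = j := by rw [Equiv.symm_apply_eq]; exact Subtype.ext (hec j).symm
    simp only [hM, Matrix.of_apply, dif_pos hPc, h1]
  have hMn : ∀ i, ¬ P i → ∀ k, M i k = if i = k then 1 else 0 := by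
    intro i hi k
    simp only [hM, Matrix.of_apply, dif_neg hi]
  have hdetM : M.det = (Matrix.of fun i j => A i (c j)).det := by
    rw [Matrix.twoBlockTriangular_det M P]
    · have h1 : Matrix.toSquareBlockProp M (fun i => ¬ P i) = 1 := by
        ext i j
        simp only [Matrix.toSquareBlockProp, Matrix.toBlock_apply, Matrix.one_apply]
        rw [hMn _ i.2]
        simp [Subtype.ext_iff]
      have h2 : (Matrix.toSquareBlockProp M P).submatrix e e = Matrix.of fun i j => A i (c j) := by
        ext i j
        simp only [Matrix.submatrix_apply, Matrix.toSquareBlockProp, Matrix.toBlock_apply, hec,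
          hMc, Matrix.of_apply]
      rw [h1, Matrix.det_one, mul_one, ← h2, Matrix.det_submatrix_equiv_self]
    · intro i hi j hj
      rw [hMn i hi, if_neg]
      rintro rfl
      exact hi hj
  have hdet' : κ ≤ |M.det| := hdetM ▸ hdet
  have hdet0 : LinearMap.det (Matrix.toLin' M) ≠ 0 := by
    rw [LinearMap.det_toLin']
    exact abs_pos.1 (hκ.trans_le hdet')
  set lo : ι → ℝ := fun i => if h : P i then -b (e.symm ⟨i, h⟩) - w (e.symm ⟨i, h⟩) else -ε with hlo
  set hi : ι → ℝ := fun i => if h : P i then -b (e.symm ⟨i, h⟩) + w (e.symm ⟨i, h⟩) else ε with hhi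
  have hsub : {t : ι → ℝ | (∀ i, |t i| ≤ ε) ∧ ∀ j, |b j + ∑ i, t i * A j i| ≤ w j} ⊆
      Matrix.toLin' M ⁻¹' Set.pi Set.univ fun i => Set.Icc (lo i) (hi i) := by
    rintro t ⟨ht1, ht2⟩
    refine Set.mem_preimage.2 fun i _ => ?_
    rw [Matrix.toLin'_apply]
    by_cases h : P i
    · obtain ⟨j, rfl⟩ := h
      have hPc : P (c j) := ⟨j, rfl⟩
      have h1 : e.symm ⟨c j, hPc⟩ = j := by rw [Equiv.symm_apply_eq]; exact Subtype.ext (hec j).symm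
      simp only [hlo, hhi, dif_pos hPc, h1, Matrix.mulVec, dotProduct, hMc]
      have h2 := abs_le.1 (ht2 j)
      simp only [mul_comm (A j _)]
      exact ⟨by linarith [h2.1], by linarith [h2.2]⟩
    · simp only [hlo, hhi, dif_neg h, Matrix.mulVec, dotProduct, hMn i h]
      have h2 := abs_le.1 (ht1 i)
      simpa using h2
  refine (measure_mono hsub).trans ?_
  have hprod : ∏ i, (hi i - lo i) = (2 * ε) ^ Fintype.card ι * ∏ j, (w j / ε) := by
    set v : ι → ℝ := fun i => if h : P i then w (e.symm ⟨i, h⟩) / ε else 1 with hv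
    have hvc : ∀ j, v (c j) = w j / ε := by
      intro j
      have hPc : P (c j) := ⟨j, rfl⟩
      have h1 : e.symm ⟨c j, hPc⟩ = j := by
        rw [Equiv.symm_apply_eq]; exact Subtype.ext (hec j).symm
      simp only [hv, dif_pos hPc, h1]
    have hvn : ∀ i, ¬ P i → v i = 1 := fun i hi => dif_neg hi
    have h1 : ∀ i, hi i - lo i = 2 * ε * v i := by
      intro i
      by_cases h : P i
      · simp only [hlo, hhi, hv, dif_pos h]
        field_simp
        ring
      · simp only [hlo, hhi, hvn i h, dif_neg h]
        ring
    rw [Finset.prod_congr rfl fun i _ => h1 i, Finset.prod_mul_distrib, Finset.prod_const,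
      Finset.card_univ]
    congr 1
    exact (Fintype.prod_of_injective c hc (fun j => w j / ε) v hvn fun j => (hvc j).symm).symm
  have hnn : ∀ i ∈ Finset.univ, 0 ≤ hi i - lo i := by
    intro i _
    by_cases h : P i
    · simp only [hlo, hhi, dif_pos h]
      linarith [hw (e.symm ⟨i, h⟩)]
    · simp only [hlo, hhi, dif_neg h]
      linarith
  rw [Measure.addHaar_preimage_linearMap volume hdet0, LinearMap.det_toLin', Set.pi_univ_Icc,
    Real.volume_Icc_pi, ← ENNReal.ofReal_prod_of_nonneg hnn, hprod,
    ← ENNReal.ofReal_mul (abs_nonneg _), mul_assoc]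
  refine ENNReal.ofReal_le_ofReal (mul_le_mul_of_nonneg_right ?_ ?_)
  · rw [abs_inv]
    exact inv_anti₀ hκ hdet'
  · exact mul_nonneg (by positivity) (Finset.prod_nonneg fun j _ => div_nonneg (hw j) hε.le)

end PartialCaptivity

/-! ### Tuples in general position and the minor they provide. -/

namespace PartialCaptivity

/-- If each element is in a bad position to few others, then at least half of the tuples are in
general position. -/
theorem card_pow_le_two_mul_card_filter {α : Type*} [DecidableEq α] (W : Finset α)
    (bad : α → α → Prop) [∀ a b, Decidable (bad a b)] {N p : ℕ}
    (hN : ∀ b ∈ W, {a ∈ W | bad a b}.card ≤ N) (hp : 2 * p ^ 2 * N ≤ W.card) :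
    W.card ^ p ≤ 2 * {f ∈ Fintype.piFinset fun _ : Fin p => W |
      ∀ i j, i ≠ j → ¬ bad (f i) (f j)}.card := by
  obtain _ | p := p
  · simp
  set T := Fintype.piFinset fun _ : Fin (p + 1) => W with hT
  have hTcard : T.card = W.card ^ (p + 1) := by simp [hT, Fintype.card_piFinset]
  -- Once the entries other than the `i`-th are fixed, at most `N` values of the `i`-th are bad for
  -- the `j`-th. Fewer than `p ^ 2` pairs then spoil at most half of the tuples, by `hp`.
  have hpair : ∀ i j : Fin (p + 1), i ≠ j →
      {f ∈ T | bad (f i) (f j)}.card ≤ N * W.card ^ p := by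
    intro i j hij
    obtain ⟨j', rfl⟩ := Fin.exists_succAbove_eq hij.symm
    have himg : ({f ∈ T | bad (f i) (f (i.succAbove j'))}.image
        fun f => fun k => f (i.succAbove k)) ⊆ Fintype.piFinset fun _ : Fin p => W := by
      refine Finset.image_subset_iff.2 fun f hf => ?_
      rw [Finset.mem_filter, hT, Fintype.mem_piFinset] at hf
      exact Fintype.mem_piFinset.2 fun k => hf.1 _
    refine (Finset.card_le_mul_card_image (f := fun f => fun k => f (i.succAbove k)) _ N ?_).trans
      (Nat.mul_le_mul_left N ((Finset.card_le_card himg).trans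
        (by simp [Fintype.card_piFinset])))
    intro g hg
    have hgW := Fintype.mem_piFinset.1 (himg hg) j'
    refine le_trans (Finset.card_le_card_of_injOn (fun f => f i) ?_ ?_) (hN (g j') hgW)
    · intro f hf
      simp only [Finset.coe_filter, Finset.mem_filter, Set.mem_ofPred_eq, hT,
        Fintype.mem_piFinset] at hf
      obtain ⟨⟨h1, h2⟩, rfl⟩ := hf
      simp only [Finset.coe_filter, Set.mem_ofPred_eq]
      exact ⟨h1 i, h2⟩
    · intro f hf f' hf' h
      have h1 := (Finset.mem_filter.1 hf).2
      have h2 := (Finset.mem_filter.1 hf').2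
      funext k
      by_cases hk : k = i
      · rw [hk]; exact h
      · obtain ⟨k', rfl⟩ := Fin.exists_succAbove_eq hk
        exact (congrFun h1 k').trans (congrFun h2 k').symm
  have hcover : T ⊆ {f ∈ T | ∀ i j, i ≠ j → ¬ bad (f i) (f j)} ∪
      ({ij : Fin (p + 1) × Fin (p + 1) | ij.1 ≠ ij.2} : Finset _).biUnion
        fun ij => {f ∈ T | bad (f ij.1) (f ij.2)} := by
    intro f hf
    by_cases h : ∀ i j, i ≠ j → ¬ bad (f i) (f j)
    · exact Finset.mem_union_left _ (Finset.mem_filter.2 ⟨hf, h⟩)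
    · push Not at h
      obtain ⟨i, j, hij, hb⟩ := h
      exact Finset.mem_union_right _ (Finset.mem_biUnion.2
        ⟨(i, j), by simpa using hij, Finset.mem_filter.2 ⟨hf, hb⟩⟩)
  have h1 := (Finset.card_le_card hcover).trans (Finset.card_union_le _ _)
  have h2 : (({ij : Fin (p + 1) × Fin (p + 1) | ij.1 ≠ ij.2} : Finset _).biUnion
        fun ij => {f ∈ T | bad (f ij.1) (f ij.2)}).card ≤ (p + 1) ^ 2 * (N * W.card ^ p) := by
    refine (Finset.card_biUnion_le_card_mul _ _ (N * W.card ^ p) fun ij hij => ?_).trans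
      (Nat.mul_le_mul_right _ ?_)
    · exact hpair ij.1 ij.2 (Finset.mem_filter.1 hij).2
    · refine (Finset.card_le_univ _).trans ?_
      simp [sq]
  have h3 := Nat.mul_le_mul_right (W.card ^ p) hp
  rw [← pow_succ'] at h3
  rw [hTcard] at h1
  nlinarith

open MeasureTheory in
/-- Markov's inequality for the number of sets of a finite family that contain a point. -/
theorem measure_le_card_mul_le {Ω F : Type*} [MeasurableSpace Ω] (μ : Measure Ω) (s : Finset F)
    (S : F → Set Ω) [∀ t, DecidablePred fun f => t ∈ S f] (hS : ∀ f ∈ s, MeasurableSet (S f))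
    (X : ℝ) :
    ENNReal.ofReal X * μ {t | X ≤ ({f ∈ s | t ∈ S f}.card : ℝ)} ≤ ∑ f ∈ s, μ (S f) := by
  classical
  have hcount : ∀ t, (({f ∈ s | t ∈ S f}.card : ℕ) : ℝ≥0∞) =
      ∑ f ∈ s, (S f).indicator (fun _ => (1 : ℝ≥0∞)) t := by
    intro t
    rw [Finset.card_filter]
    push_cast
    exact Finset.sum_congr rfl fun f _ => by by_cases h : t ∈ S f <;> simp [h]
  have hmeas : ∀ f ∈ s, Measurable ((S f).indicator fun _ => (1 : ℝ≥0∞)) := fun f hf =>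
    measurable_const.indicator (hS f hf)
  calc _ ≤ ENNReal.ofReal X * μ {t | ENNReal.ofReal X ≤
        ∑ f ∈ s, (S f).indicator (fun _ => (1 : ℝ≥0∞)) t} := by
        gcongr with t
        intro ht
        rw [← hcount, ← ENNReal.ofReal_natCast]
        exact ENNReal.ofReal_le_ofReal ht
    _ ≤ ∫⁻ t, ∑ f ∈ s, (S f).indicator (fun _ => (1 : ℝ≥0∞)) t ∂μ :=
        mul_meas_ge_le_lintegral (Finset.measurable_fun_sum _ hmeas) _
    _ = ∑ f ∈ s, μ (S f) := by
        rw [lintegral_finsetSum _ hmeas]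
        refine Finset.sum_congr rfl fun f hf => ?_
        rw [lintegral_indicator_const (hS f hf), one_mul]

namespace InverseLift

variable (G : InverseLift)

section Slope

variable {lam : ℝ}

theorem slope_nonneg {g : ℝ → ℝ} (hg : ∀ u, 0 ≤ g u) (n : ℕ) (u : ℝ) : 0 ≤ G.slope g n u := by
  induction n generalizing u with
  | zero => exact le_rfl
  | succ n ih => exact mul_nonneg (add_nonneg (ih _) (hg _)) (G.rate_pos u).le

/-- The slope is the sum over `1 ≤ k ≤ n` of `g (G^k u) * weight k u`; one term of a nonnegative sum
is kept. -/
theorem le_slope_of_nonneg {g : ℝ → ℝ} (hg : ∀ u, 0 ≤ g u) {k n : ℕ} (hk : 1 ≤ k) (hkn : k ≤ n)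
    (u : ℝ) : g (G.toFun^[k] u) * G.weight k u ≤ G.slope g n u := by
  obtain ⟨k, rfl⟩ := Nat.exists_eq_add_of_le' hk
  obtain ⟨n, rfl⟩ := Nat.exists_eq_add_of_le hkn
  have h1 := G.slope_nonneg hg k u
  have h2 := G.slope_nonneg hg n (G.toFun^[k + 1] u)
  have h3 := G.weight_pos (k + 1) u
  rw [G.slope_add g (k + 1) n, G.slope_add g k 1, G.weight_add k 1, Function.iterate_succ_apply'] at *
  simp only [slope, weight, zero_add, one_mul] at *
  nlinarith [mul_nonneg h3.le h2]

theorem le_slope (hlam : 1 < lam) (h : ∀ u, G.rate u ≤ lam⁻¹) {g : ℝ → ℝ} {η : ℝ} (hη : 0 ≤ η)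
    (hg : ∀ u, -η ≤ g u) {k n : ℕ} (hk : 1 ≤ k) (hkn : k ≤ n) (u : ℝ) :
    g (G.toFun^[k] u) * G.weight k u - η / (lam - 1) ≤ G.slope g n u := by
  -- Adding the constant `η` makes `g` nonnegative and changes the slope by at most `η / (lam - 1)`.
  have h1 := G.le_slope_of_nonneg (g := fun x => g x + η * 1)
    (fun u => by linarith [hg u]) hk hkn u
  rw [G.slope_add_smul g (fun _ => 1)] at h1
  have h2 := (abs_le.1 (G.abs_slope_le hlam h (g := fun _ => 1) (R := 1) (by simp) n u)).2
  have h3 : η * G.slope (fun _ => 1) n u ≤ η / (lam - 1) := by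
    calc _ ≤ η * (1 / (lam - 1)) := by gcongr
      _ = _ := by ring
  have h4 : 0 ≤ η * 1 * G.weight k u := mul_nonneg (by linarith) (G.weight_pos _ _).le
  simp only [add_mul] at h1
  linarith

theorem abs_slope_le_of_orbit (hlam : 1 < lam) (h : ∀ u, G.rate u ≤ lam⁻¹) {g : ℝ → ℝ} {η : ℝ}
    (hη : 0 ≤ η) {n : ℕ} {u : ℝ} (hg : ∀ k, 1 ≤ k → k ≤ n → |g (G.toFun^[k] u)| ≤ η) :
    |G.slope g n u| ≤ η / (lam - 1) := by
  have hl : 0 < lam - 1 := by linarith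
  induction n generalizing u with
  | zero => simp only [slope, abs_zero]; positivity
  | succ n ih =>
    have h1 := ih (u := G.toFun u) fun k hk hkn => by
      rw [← Function.iterate_succ_apply]; exact hg (k + 1) (by omega) (by omega)
    have h2 := hg 1 le_rfl (by omega)
    rw [Function.iterate_one] at h2
    have h3 := (G.rate_pos u).le
    rw [slope, abs_mul, abs_of_pos (G.rate_pos u)]
    calc _ ≤ (η / (lam - 1) + η) * lam⁻¹ := by
          have h4 := h u
          gcongr
          exact (abs_add_le _ _).trans (add_le_add h1 h2)
      _ = η / (lam - 1) := by field_simp; ring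

/-- Only the first `K` points of the orbit need to avoid the bump: the rest of the sum carries the
factor `weight K ≤ lam⁻¹ ^ K`. -/
theorem abs_slope_le_of_initial_orbit (hlam : 1 < lam) (h : ∀ u, G.rate u ≤ lam⁻¹) {g : ℝ → ℝ}
    {η : ℝ} (hη : 0 ≤ η) (hg1 : ∀ u, |g u| ≤ 1) {K n : ℕ} (hK : K ≤ n) {u : ℝ}
    (hg : ∀ k, 1 ≤ k → k ≤ K → |g (G.toFun^[k] u)| ≤ η) :
    |G.slope g n u| ≤ (η + lam⁻¹ ^ K) / (lam - 1) := by
  obtain ⟨n, rfl⟩ := Nat.exists_eq_add_of_le hK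
  have hl : 0 < lam - 1 := by linarith
  rw [slope_add, add_div]
  refine (abs_add_le _ _).trans (add_le_add (G.abs_slope_le_of_orbit hlam h hη hg) ?_)
  rw [abs_mul, abs_of_pos (G.weight_pos _ _), ← mul_one_div]
  exact mul_le_mul (G.weight_le hlam h K u) (G.abs_slope_le hlam h hg1 n _) (abs_nonneg _)
    (pow_nonneg (inv_nonneg.2 (by linarith)) K)

end Slope

/-- The point `G^q (y + m)` is `ρ`-far, modulo 1, from the points `G^k (y + m')`, `1 ≤ k ≤ K`. -/
def Separated (ρ : ℝ) (q K : ℕ) (y : ℝ) (m m' : ℕ) : Prop :=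
  ∀ k, 1 ≤ k → k ≤ K → ∀ i : ℤ, ρ ≤ |G.toFun^[k] (y + m') - G.toFun^[q] (y + m) - i|

theorem le_abs_iterate_sub {Lam : ℝ} (hLam : 0 < Lam) (h : ∀ u, Lam⁻¹ ≤ G.rate u) (n : ℕ)
    (u v : ℝ) : Lam⁻¹ ^ n * |u - v| ≤ |G.toFun^[n] u - G.toFun^[n] v| := by
  wlog huv : v ≤ u generalizing u v
  · rw [abs_sub_comm u, abs_sub_comm (G.toFun^[n] u)]
    exact this v u (le_of_not_ge huv)
  rw [abs_of_nonneg (sub_nonneg.2 huv)]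
  refine le_trans ?_ (le_abs_self _)
  refine mul_sub_le_image_sub_of_le_deriv
    (fun x => (G.hasDerivAt_iterate n x).differentiableAt) (fun x => ?_) huv
  rw [(G.hasDerivAt_iterate n x).deriv]
  exact G.le_weight hLam h n x

/-- As `G^n` contracts by at most `Lam ^ n`, the points `y + m` and `y + m'` are less than 1 apart
modulo `degree ^ n`; their difference is an integer, hence zero modulo `degree ^ n`. -/
theorem mod_eq_of_abs_lt {Lam : ℝ} (hLam : 0 < Lam) (h : ∀ u, Lam⁻¹ ≤ G.rate u) {n : ℕ} {y : ℝ}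
    {m m' : ℕ} {i : ℤ}
    (hlt : |G.toFun^[n] (y + m) - G.toFun^[n] (y + m') - i| < Lam⁻¹ ^ n) :
    m % G.degree ^ n = m' % G.degree ^ n := by
  rw [sub_sub, ← G.iterate_add_pow_mul] at hlt
  have h1 := (G.le_abs_iterate_sub hLam h n _ _).trans_lt hlt
  have h2 : |y + m - (y + m' + (G.degree : ℝ) ^ n * i)| < 1 := by
    have : 0 < Lam⁻¹ ^ n := by positivity
    by_contra! hcon
    exact absurd h1 (not_lt.2 (le_mul_of_one_le_right this.le hcon))
  rw [show y + m - (y + m' + (G.degree : ℝ) ^ n * i) =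
    (((m : ℤ) - m' - ((G.degree ^ n : ℕ) : ℤ) * i : ℤ) : ℝ) by push_cast; ring] at h2
  have h3 : |(m : ℤ) - m' - ((G.degree ^ n : ℕ) : ℤ) * i| < 1 := by exact_mod_cast h2
  rw [Int.abs_lt_one_iff] at h3
  have h4 : (m : ℤ) = m' + ((G.degree ^ n : ℕ) : ℤ) * i := by linarith
  have h5 := congrArg (· % ((G.degree ^ n : ℕ) : ℤ)) h4
  simp only [Int.add_mul_emod_self_left] at h5
  exact_mod_cast h5

open Classical in
-- For each `k ≤ K`, all `m` with `G^q (y' + m)` within `ρ` of `G^k (y' + m')` are within `2 ρ ≤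
-- Lam⁻¹ ^ q` of one another, hence have the same residue modulo `degree ^ q`. At most `multiplicity
-- ϑ g n` hits have a given residue.
theorem card_filter_not_separated_le {Lam : ℝ} (hLam : 0 < Lam) (h : ∀ u, Lam⁻¹ ≤ G.rate u)
    {g : ℝ → ℝ} (hg : Function.Periodic g 1) {ρ : ℝ} {q : ℕ} (hρ : 2 * ρ ≤ Lam⁻¹ ^ q) (K n : ℕ)
    (ϑ y s y' : ℝ) (m' : ℕ) :
    {m ∈ G.hits ϑ g (q + n) y s | ¬ G.Separated ρ q K y' m m'}.card ≤
      K * G.multiplicity ϑ g n := by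
  have hcover : {m ∈ G.hits ϑ g (q + n) y s | ¬ G.Separated ρ q K y' m m'} ⊆
      (Finset.Icc 1 K).biUnion fun k => {m ∈ G.hits ϑ g (q + n) y s |
        ∃ i : ℤ, |G.toFun^[k] (y' + m') - G.toFun^[q] (y' + m) - i| < ρ} := by
    intro m hm
    obtain ⟨hm1, hm2⟩ := Finset.mem_filter.1 hm
    simp only [Separated, not_forall, not_le] at hm2
    obtain ⟨k, hk1, hk2, i, hi⟩ := hm2
    exact Finset.mem_biUnion.2 ⟨k, Finset.mem_Icc.2 ⟨hk1, hk2⟩, Finset.mem_filter.2 ⟨hm1, i, hi⟩⟩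
  refine (Finset.card_le_card hcover).trans ?_
  refine (Finset.card_biUnion_le_card_mul _ _ (G.multiplicity ϑ g n) fun k _ => ?_).trans
    (by simp)
  rcases Finset.eq_empty_or_nonempty ({m ∈ G.hits ϑ g (q + n) y s |
        ∃ i : ℤ, |G.toFun^[k] (y' + m') - G.toFun^[q] (y' + m) - i| < ρ} : Finset ℕ) with h0 | ⟨m₀, hm₀⟩
  · simp [h0]
  · obtain ⟨-, i₀, hi₀⟩ := Finset.mem_filter.1 hm₀
    refine (Finset.card_le_card ?_).trans
      (G.card_filter_mod_le ϑ hg q n y s (m₀ % G.degree ^ q))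
    intro m hm
    obtain ⟨hm1, i, hi⟩ := Finset.mem_filter.1 hm
    refine Finset.mem_filter.2 ⟨hm1, G.mod_eq_of_abs_lt hLam h (y := y') (i := i₀ - i) ?_⟩
    have h1 := abs_sub (G.toFun^[k] (y' + m') - G.toFun^[q] (y' + m₀) - i₀)
      (G.toFun^[k] (y' + m') - G.toFun^[q] (y' + m) - i)
    rw [show G.toFun^[k] (y' + m') - G.toFun^[q] (y' + m₀) - i₀ -
      (G.toFun^[k] (y' + m') - G.toFun^[q] (y' + m) - i) =
      G.toFun^[q] (y' + m) - G.toFun^[q] (y' + m₀) - ((i₀ - i : ℤ) : ℝ) by push_cast; ring] at h1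
    linarith

/-- At points in general position the matrix of the slopes of suitable bumps is nearly diagonal. -/
theorem exists_minor {lam : ℝ} (hlam : 1 < lam) (h : ∀ u, G.rate u ≤ lam⁻¹) {Lam : ℝ}
    (hLam : 0 < Lam) (h' : ∀ u, Lam⁻¹ ≤ G.rate u) {D p q K n : ℕ} (hq : 1 ≤ q) (hqK : q ≤ K)
    (hKn : K ≤ n) {ρ η : ℝ} (hη : 0 < η) (hη1 : η < 1 / 4)
    (hηq : η / (lam - 1) ≤ Lam⁻¹ ^ q / 8)
    (hsmall : p.factorial * ((η + lam⁻¹ ^ K) / (lam - 1) * (1 + 1 / (lam - 1)) ^ p) ≤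
      (Lam⁻¹ ^ q / 8) ^ p / 2)
    {φ : Fin D → ℝ → ℝ} (hφ : ∀ c u, -η ≤ φ c u ∧ φ c u ≤ 1)
    (hbump : ∀ x, ∃ c, 1 / 4 ≤ φ c x ∧ ∀ x', (∀ i : ℤ, ρ ≤ |x' - x - i|) → φ c x' ≤ η)
    {y : ℝ} {f : Fin p → ℕ} (hf : ∀ i j, i ≠ j → G.Separated ρ q K y (f i) (f j)) :
    ∃ c : Fin p → Fin D, Function.Injective c ∧
      (Lam⁻¹ ^ q / 8) ^ p / 2 ≤
        |(Matrix.of fun i j => G.slope (φ (c j)) n (y + f i)).det| := by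
  have hl : 0 < lam - 1 := by linarith
  have hφ1 : ∀ c u, |φ c u| ≤ 1 := fun c u =>
    abs_le.2 ⟨by linarith [(hφ c u).1], (hφ c u).2⟩
  choose c hc1 hc2 using fun i => hbump (G.toFun^[q] (y + f i))
  refine ⟨c, ?_, ?_⟩
  -- A bump shared by `i` and `j` would be at least `1 / 4` at `G^q (y + f j)`, yet at most `η`
  -- there by separation at time `k = q`; this uses `q ≤ K`.
  · intro i j hij
    by_contra hne
    have h1 := hc2 i (G.toFun^[q] (y + f j)) (hf i j hne q hq hqK)
    rw [hij] at h1
    linarith [hc1 j]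
  · have hk : 0 ≤ lam⁻¹ ^ K := pow_nonneg (inv_nonneg.2 (by linarith)) K
    refine le_trans ?_ (sub_le_abs_det _ (d := Lam⁻¹ ^ q / 8)
      (η := (η + lam⁻¹ ^ K) / (lam - 1)) (A := 1 + 1 / (lam - 1)) (by positivity)
      (by positivity) (by linarith [one_div_pos.2 hl]) ?_ ?_ ?_)
    · linarith
    · intro i
      rw [Matrix.of_apply]
      have h1 := G.le_slope hlam h hη.le (fun u => (hφ (c i) u).1) hq (hqK.trans hKn) (y + f i)
      have h2 := G.le_weight hLam h' q (y + f i)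
      have h3 := hc1 i
      -- The visit at time `q` contributes a quarter of `Lam⁻¹ ^ q`, and the negative part of the
      -- bump takes away at most an eighth. Further visits of the orbit to its own bump only
      -- increase the entry.
      have h4 : 1 / 4 * Lam⁻¹ ^ q ≤ φ (c i) (G.toFun^[q] (y + f i)) * G.weight q (y + f i) :=
        mul_le_mul h3 h2 (by positivity) (by linarith)
      linarith
    · intro i j
      rw [Matrix.of_apply]
      linarith [G.abs_slope_le hlam h (hφ1 (c j)) n (y + f i)]
    · intro i j hij
      rw [Matrix.of_apply]
      refine G.abs_slope_le_of_initial_orbit hlam h hη.le (hφ1 (c j)) hKn fun k hk1 hk2 => ?_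
      exact abs_le.2 ⟨(hφ _ _).1, hc2 j _ (hf j i hij.symm k hk1 hk2)⟩

end InverseLift

end PartialCaptivity

/-! ### Volume of the parameters with many overlaps. -/

namespace PartialCaptivity

namespace InverseLift

variable (G : InverseLift)

theorem hits_add_pow_mul {g : ℝ → ℝ} (hg : Function.Periodic g 1) (ϑ : ℝ) (n : ℕ) (y s : ℝ)
    (i : ℤ) : G.hits ϑ g n (y + (G.degree : ℝ) ^ n * i) s = G.hits ϑ g n y s := by
  ext m
  rw [mem_hits, mem_hits, add_right_comm, G.slope_add_pow_mul hg, G.weight_add_pow_mul]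

theorem exists_card_hits_eq_of_mem_Ico {g : ℝ → ℝ} (hg : Function.Periodic g 1) (ϑ : ℝ) (n : ℕ) :
    ∃ y s, 0 ≤ y ∧ y < (G.degree : ℝ) ^ n ∧ (G.hits ϑ g n y s).card = G.multiplicity ϑ g n := by
  obtain ⟨y, s, h⟩ := G.exists_card_hits_eq ϑ g n
  have hd : (0 : ℝ) < (G.degree : ℝ) ^ n := pow_pos (by exact_mod_cast G.degree_pos) n
  have h1 := Int.floor_le (y / (G.degree : ℝ) ^ n)
  have h2 := Int.lt_floor_add_one (y / (G.degree : ℝ) ^ n)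
  rw [le_div_iff₀ hd] at h1
  rw [div_lt_iff₀ hd] at h2
  refine ⟨y + (G.degree : ℝ) ^ n * ((-⌊y / (G.degree : ℝ) ^ n⌋ : ℤ) : ℝ), s, ?_, ?_, ?_⟩
  · push_cast; linarith
  · push_cast; linarith
  · rw [G.hits_add_pow_mul hg, h]

open Classical in
/-- The tuples of points in general position at `y` for which the slopes, for the parameter `t`,
are close to `s`. -/
noncomputable def clusters {D : ℕ} (p : ℕ) (ρ : ℝ) (q K : ℕ) (C : ℝ) (g : ℝ → ℝ)
    (φ : Fin D → ℝ → ℝ) (n : ℕ) (y s : ℝ) (t : Fin D → ℝ) : Finset (Fin p → ℕ) :=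
  {f ∈ Fintype.piFinset fun _ : Fin p => Finset.range (G.degree ^ n) |
    (∀ i j, i ≠ j → G.Separated ρ q K y (f i) (f j)) ∧
    ∀ j, |G.slope g n (y + f j) - s + ∑ i, t i * G.slope (φ i) n (y + f j)| ≤
      C * G.weight n (y + f j)}

open MeasureTheory in
theorem volume_clusters_le {lam : ℝ} (hlam : 1 < lam) (h : ∀ u, G.rate u ≤ lam⁻¹) {Lam : ℝ}
    (hLam : 0 < Lam) (h' : ∀ u, Lam⁻¹ ≤ G.rate u) {D p q K n : ℕ} (hq : 1 ≤ q) (hqK : q ≤ K)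
    (hKn : K ≤ n) {ρ η : ℝ} (hη : 0 < η) (hη1 : η < 1 / 4)
    (hηq : η / (lam - 1) ≤ Lam⁻¹ ^ q / 8)
    (hsmall : p.factorial * ((η + lam⁻¹ ^ K) / (lam - 1) * (1 + 1 / (lam - 1)) ^ p) ≤
      (Lam⁻¹ ^ q / 8) ^ p / 2)
    {φ : Fin D → ℝ → ℝ} (hφ : ∀ c u, -η ≤ φ c u ∧ φ c u ≤ 1)
    (hbump : ∀ x, ∃ c, 1 / 4 ≤ φ c x ∧ ∀ x', (∀ i : ℤ, ρ ≤ |x' - x - i|) → φ c x' ≤ η)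
    (y s : ℝ) (g : ℝ → ℝ) {C C' ε X : ℝ} (hC : 0 ≤ C) (hε : 0 < ε) (hX : 0 < X)
    (hC' : ∑ m ∈ Finset.range (G.degree ^ n), G.weight n (y + m) ≤ C') :
    volume {t : Fin D → ℝ | (∀ i, |t i| ≤ ε) ∧
        X ≤ ((G.clusters p ρ q K C g φ n y s t).card : ℝ)} ≤
      ENNReal.ofReal (((Lam⁻¹ ^ q / 8) ^ p / 2)⁻¹ * (2 * ε) ^ D * (C * C' / ε) ^ p / X) := by
  classical
  set κ := (Lam⁻¹ ^ q / 8) ^ p / 2 with hκ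
  have hκ0 : 0 < κ := by positivity
  set F : Finset (Fin p → ℕ) := {f ∈ Fintype.piFinset fun _ : Fin p =>
    Finset.range (G.degree ^ n) | ∀ i j, i ≠ j → G.Separated ρ q K y (f i) (f j)} with hF
  set S : (Fin p → ℕ) → Set (Fin D → ℝ) := fun f => {t | (∀ i, |t i| ≤ ε) ∧
    ∀ j, |G.slope g n (y + f j) - s + ∑ i, t i * G.slope (φ i) n (y + f j)| ≤
      C * G.weight n (y + f j)} with hS
  have hw : ∀ (f : Fin p → ℕ) j, 0 ≤ C * G.weight n (y + f j) := fun f j =>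
    mul_nonneg hC (G.weight_pos _ _).le
  have hSm : ∀ f ∈ F, MeasurableSet (S f) := by
    intro f _
    refine IsClosed.measurableSet ?_
    have e : S f = (⋂ i, {t | |t i| ≤ ε}) ∩ ⋂ j, {t | |G.slope g n (y + f j) - s +
        ∑ i, t i * G.slope (φ i) n (y + f j)| ≤ C * G.weight n (y + f j)} := by
      ext t; simp [hS]
    rw [e]
    refine (isClosed_iInter fun i => isClosed_le (by fun_prop) continuous_const).inter
      (isClosed_iInter fun j => isClosed_le (by fun_prop) continuous_const)
  have hSv : ∀ f ∈ F, volume (S f) ≤ ENNReal.ofReal (κ⁻¹ * (2 * ε) ^ D *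
      ∏ j, (C * G.weight n (y + f j) / ε)) := by
    intro f hf
    obtain ⟨c, hc, hdet⟩ := G.exists_minor hlam h hLam h' hq hqK hKn hη hη1 hηq hsmall hφ hbump
      (Finset.mem_filter.1 hf).2
    have := volume_affine_box_le c hc (fun j i => G.slope (φ i) n (y + f j))
      (fun j => G.slope g n (y + f j) - s) (fun j => C * G.weight n (y + f j)) (hw f) hκ0 hε hdet
    rwa [Fintype.card_fin] at this
  have hsub : {t : Fin D → ℝ | (∀ i, |t i| ≤ ε) ∧
        X ≤ ((G.clusters p ρ q K C g φ n y s t).card : ℝ)} ⊆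
      {t | X ≤ ({f ∈ F | t ∈ S f}.card : ℝ)} := by
    rintro t ⟨ht1, ht2⟩
    refine ht2.trans (Nat.cast_le.2 (Finset.card_le_card fun f hf => ?_))
    obtain ⟨hf1, hf2, hf3⟩ := Finset.mem_filter.1 hf
    exact Finset.mem_filter.2 ⟨Finset.mem_filter.2 ⟨hf1, hf2⟩, ht1, hf3⟩
  -- Summed over all tuples, the product of the weights factors into the `p`-th power of the sum of
  -- the weights.
  have hsum : ∑ f ∈ F, ∏ j, (C * G.weight n (y + f j) / ε) ≤ (C * C' / ε) ^ p := by
    have h1 : ∑ f ∈ F, ∏ j, (C * G.weight n (y + f j) / ε) ≤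
        ∑ f ∈ Fintype.piFinset fun _ : Fin p => Finset.range (G.degree ^ n),
          ∏ j, (C * G.weight n (y + f j) / ε) :=
      Finset.sum_le_sum_of_subset_of_nonneg (Finset.filter_subset _ _) fun f _ _ =>
        Finset.prod_nonneg fun j _ => div_nonneg (hw f j) hε.le
    refine h1.trans ?_
    rw [← Finset.prod_univ_sum (fun _ : Fin p => Finset.range (G.degree ^ n))
      (fun _ m => C * G.weight n (y + m) / ε), Finset.prod_const, Finset.card_univ,
      Fintype.card_fin, ← Finset.sum_div, ← Finset.mul_sum]
    have h0 : 0 ≤ ∑ m ∈ Finset.range (G.degree ^ n), G.weight n (y + m) :=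
      Finset.sum_nonneg fun m _ => (G.weight_pos _ _).le
    gcongr
  have hmarkov := measure_le_card_mul_le volume F S hSm X
  have hX' : ENNReal.ofReal X ≠ 0 := (ENNReal.ofReal_pos.2 hX).ne'
  have hpos : 0 ≤ κ⁻¹ * (2 * ε) ^ D := by positivity
  rw [ENNReal.ofReal_div_of_pos hX, ENNReal.le_div_iff_mul_le (Or.inl hX') (Or.inl ENNReal.ofReal_ne_top),
    mul_comm]
  calc _ ≤ ENNReal.ofReal X * volume {t | X ≤ ({f ∈ F | t ∈ S f}.card : ℝ)} := by gcongr
    _ ≤ ∑ f ∈ F, volume (S f) := hmarkov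
    _ ≤ ∑ f ∈ F, ENNReal.ofReal (κ⁻¹ * (2 * ε) ^ D * ∏ j, (C * G.weight n (y + f j) / ε)) :=
        Finset.sum_le_sum hSv
    _ = ENNReal.ofReal (κ⁻¹ * (2 * ε) ^ D * ∑ f ∈ F, ∏ j, (C * G.weight n (y + f j) / ε)) := by
        rw [Finset.mul_sum, ENNReal.ofReal_sum_of_nonneg]
        exact fun f _ => mul_nonneg hpos (Finset.prod_nonneg fun j _ => div_nonneg (hw f j) hε.le)
    _ ≤ _ := ENNReal.ofReal_le_ofReal (mul_le_mul_of_nonneg_left hsum hpos)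

/-- If many inverse branches at `(y, s)` overlap, then there are many clusters at each point
close to `(y, s)`. -/
theorem pow_le_two_mul_card_clusters {lam : ℝ} (hlam : 1 < lam) (h : ∀ u, G.rate u ≤ lam⁻¹)
    {Lam : ℝ} (hLam : 1 ≤ Lam) (h' : ∀ u, Lam⁻¹ ≤ G.rate u) {B : ℝ} (hB0 : 0 ≤ B)
    (hBlip : ∀ u v, |G.rate u - G.rate v| ≤ B * |u - v|)
    (hB : ∀ u v, G.rate u ≤ G.rate v * Real.exp (B * |u - v|)) {D p q K n : ℕ} (hqn : q ≤ n)
    {ρ : ℝ} (hρ : 2 * ρ ≤ Lam⁻¹ ^ q) {g : ℝ → ℝ} {φ : Fin D → ℝ → ℝ} {t : Fin D → ℝ} {R ϑ : ℝ}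
    (hϑ : 0 ≤ ϑ) (hper : Function.Periodic (fun u => g u + ∑ i, t i * φ i u) 1)
    (hbd : ∀ u, |g u + ∑ i, t i * φ i u| ≤ R)
    (hlip : ∀ u v, |(g u + ∑ i, t i * φ i u) - (g v + ∑ i, t i * φ i v)| ≤ R * |u - v|)
    {y s y' s' : ℝ} (hy : |y - y'| ≤ Lam⁻¹ ^ n) (hs : |s - s'| ≤ Lam⁻¹ ^ n)
    (hcard : 2 * p ^ 2 * (K * G.multiplicity ϑ (fun u => g u + ∑ i, t i * φ i u) (n - q)) ≤
      (G.hits ϑ (fun u => g u + ∑ i, t i * φ i u) n y s).card) :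
    (G.hits ϑ (fun u => g u + ∑ i, t i * φ i u) n y s).card ^ p ≤
      2 * (G.clusters p ρ q K ((R + (R / (lam - 1) + R) * B) * lam / (lam - 1) +
        ϑ * Real.exp (B * lam / (lam - 1)) + 1) g φ n y' s' t).card := by
  classical
  have hLam0 : 0 < Lam := by linarith
  have hl : 0 < lam - 1 := by linarith
  have hR : 0 ≤ R := (abs_nonneg _).trans (hbd 0)
  set gt : ℝ → ℝ := fun u => g u + ∑ i, t i * φ i u with hgt
  set L := (R + (R / (lam - 1) + R) * B) * lam / (lam - 1) with hL
  have hL0 : 0 ≤ L := by positivity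
  have hbad : ∀ b ∈ G.hits ϑ gt n y s,
      {a ∈ G.hits ϑ gt n y s | ¬ G.Separated ρ q K y' a b}.card ≤
        K * G.multiplicity ϑ gt (n - q) := by
    intro b _
    have := G.card_filter_not_separated_le hLam0 h' hper hρ K (n - q) ϑ y s y' b
    rw [Nat.add_sub_cancel' hqn] at this
    convert this
  refine (card_pow_le_two_mul_card_filter _ (fun a b => ¬ G.Separated ρ q K y' a b) hbad
    hcard).trans (Nat.mul_le_mul_left 2 (Finset.card_le_card fun f hf => ?_))
  obtain ⟨hf1, hf2⟩ := Finset.mem_filter.1 hf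
  rw [Fintype.mem_piFinset] at hf1
  refine Finset.mem_filter.2 ⟨Fintype.mem_piFinset.2 fun j =>
    Finset.mem_range.2 (G.mem_hits.1 (hf1 j)).1, fun i j hij => not_not.1 (hf2 i j hij),
    fun j => ?_⟩
  have h1 := (G.mem_hits.1 (hf1 j)).2
  -- The mesh `Lam⁻¹ ^ n` is at most every weight of order `n`, so moving to the grid point costs
  -- only a constant multiple of the weight.
  have h2 := G.le_weight hLam0 h' n (y' + f j)
  have h3 := G.abs_slope_sub_le hlam h hBlip hbd hlip n (y' + f j) (y + f j)
  have h4 := G.weight_le_exp_mul hlam h hB0 hB n (y + f j) (y' + f j)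
  have hyy : |y' + f j - (y + f j)| ≤ Lam⁻¹ ^ n := by
    rw [add_sub_add_right_eq_sub, abs_sub_comm]; exact hy
  have h5 : |y + f j - (y' + f j)| ≤ 1 := by
    rw [abs_sub_comm]
    exact hyy.trans (pow_le_one₀ (by positivity) (inv_le_one_of_one_le₀ hLam))
  have h6 : L * |y' + f j - (y + f j)| ≤ L * G.weight n (y' + f j) :=
    mul_le_mul_of_nonneg_left (hyy.trans h2) hL0
  have h7 : ϑ * G.weight n (y + f j) ≤
      ϑ * (G.weight n (y' + f j) * Real.exp (B * lam / (lam - 1))) := by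
    refine mul_le_mul_of_nonneg_left (h4.trans ?_) hϑ
    have := (G.weight_pos n (y' + f j)).le
    gcongr
    exact mul_le_of_le_one_right (by positivity) h5
  have e : G.slope g n (y' + f j) - s' + ∑ i, t i * G.slope (φ i) n (y' + f j) =
      (G.slope gt n (y' + f j) - G.slope gt n (y + f j)) + (G.slope gt n (y + f j) - s) +
        (s - s') := by
    rw [hgt, G.slope_add_sum Finset.univ g φ t n (y' + f j)]
    ring
  rw [e]
  refine (abs_add_le _ _).trans ((add_le_add (abs_add_le _ _) le_rfl).trans ?_)
  calc _ ≤ L * G.weight n (y' + f j) +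
        ϑ * (G.weight n (y' + f j) * Real.exp (B * lam / (lam - 1))) +
        G.weight n (y' + f j) :=
        add_le_add (add_le_add (h3.trans h6) (h1.trans h7)) (hs.trans h2)
    _ = _ := by ring

theorem exists_grid_point {N : ℕ} (hN : 0 < N) (x : ℝ) :
    |x - ⌊x * N⌋ / (N : ℝ)| ≤ (N : ℝ)⁻¹ := by
  have hN' : (0 : ℝ) < N := by exact_mod_cast hN
  have h1 := Int.floor_le (x * N)
  have h2 := Int.lt_floor_add_one (x * N)
  rw [abs_le, inv_eq_one_div]
  constructor
  · rw [neg_le_sub_iff_le_add, ← sub_le_iff_le_add, ← sub_div, div_le_iff₀ hN']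
    linarith
  · rw [sub_le_iff_le_add, ← add_div, le_div_iff₀ hN']
    linarith

open MeasureTheory in
/-- The parameters for which many inverse branches of order `n` overlap, not many of which have a
common initial part of order `q`, have exponentially small volume. -/
theorem exists_volume_overlap_le {lam : ℝ} (hlam : 1 < lam) (h : ∀ u, G.rate u ≤ lam⁻¹) {Lam : ℕ}
    (hLam : 1 ≤ Lam) (h' : ∀ u, (Lam : ℝ)⁻¹ ≤ G.rate u) {B : ℝ} (hB0 : 0 ≤ B)
    (hBlip : ∀ u v, |G.rate u - G.rate v| ≤ B * |u - v|)
    (hB : ∀ u v, G.rate u ≤ G.rate v * Real.exp (B * |u - v|))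
    {D p q K : ℕ} (hq : 1 ≤ q) (hqK : q ≤ K) {ρ η : ℝ} (hρ : 2 * ρ ≤ (Lam : ℝ)⁻¹ ^ q)
    (hη : 0 < η) (hη1 : η < 1 / 4) (hηq : η / (lam - 1) ≤ (Lam : ℝ)⁻¹ ^ q / 8)
    (hsmall : p.factorial * ((η + lam⁻¹ ^ K) / (lam - 1) * (1 + 1 / (lam - 1)) ^ p) ≤
      ((Lam : ℝ)⁻¹ ^ q / 8) ^ p / 2)
    {φ : Fin D → ℝ → ℝ} (hφ : ∀ c u, -η ≤ φ c u ∧ φ c u ≤ 1)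
    (hbump : ∀ x, ∃ c, 1 / 4 ≤ φ c x ∧ ∀ x', (∀ i : ℤ, ρ ≤ |x' - x - i|) → φ c x' ≤ η)
    {g : ℝ → ℝ} {R ε ϱ : ℝ} (hε : 0 < ε) (hϱ : 0 < ϱ)
    (hper : ∀ t : Fin D → ℝ, Function.Periodic (fun u => g u + ∑ i, t i * φ i u) 1)
    (hbd : ∀ t : Fin D → ℝ, (∀ i, |t i| ≤ ε) → ∀ u, |g u + ∑ i, t i * φ i u| ≤ R)
    (hlip : ∀ t : Fin D → ℝ, (∀ i, |t i| ≤ ε) →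
      ∀ u v, |(g u + ∑ i, t i * φ i u) - (g v + ∑ i, t i * φ i v)| ≤ R * |u - v|) :
    ∃ C : ℝ, 0 ≤ C ∧ ∀ n, K ≤ n →
      volume {t : Fin D → ℝ | (∀ i, |t i| ≤ ε) ∧
        ϱ ^ n ≤ (G.multiplicity (R / (lam - 1)) (fun u => g u + ∑ i, t i * φ i u) n : ℝ) ∧
        2 * p ^ 2 * (K * G.multiplicity (R / (lam - 1)) (fun u => g u + ∑ i, t i * φ i u) (n - q))
          ≤ G.multiplicity (R / (lam - 1)) (fun u => g u + ∑ i, t i * φ i u) n} ≤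
      ENNReal.ofReal (C * (G.degree * Lam ^ 2 / ϱ ^ p) ^ n) := by
  have hl : 0 < lam - 1 := by linarith
  have hLam0 : (0 : ℝ) < Lam := by exact_mod_cast hLam
  have hR : 0 ≤ R := (abs_nonneg _).trans (hbd 0 (by simp [hε.le]) 0)
  set ϑ := R / (lam - 1) with hϑ
  have hϑ0 : 0 ≤ ϑ := by positivity
  obtain ⟨J, hJ⟩ := exists_nat_ge ϑ
  set C₁ := (R + (R / (lam - 1) + R) * B) * lam / (lam - 1) +
        ϑ * Real.exp (B * lam / (lam - 1)) + 1 with hC₁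
  have hC₁0 : 0 ≤ C₁ := by positivity
  set V := (((Lam : ℝ)⁻¹ ^ q / 8) ^ p / 2)⁻¹ * (2 * ε) ^ D *
    (C₁ * Real.exp (B * lam / (lam - 1)) / ε) ^ p with hV
  have hV0 : 0 ≤ V := by positivity
  refine ⟨(2 * J + 1) * (2 * V), by positivity, fun n hn => ?_⟩
  set X := (ϱ ^ n) ^ p / 2 with hX
  have hX0 : 0 < X := by positivity
  set cell : ℤ × ℤ → Set (Fin D → ℝ) := fun ab => {t | (∀ i, |t i| ≤ ε) ∧
        X ≤ ((G.clusters p ρ q K C₁ g φ n (ab.1 / ((Lam ^ n : ℕ) : ℝ))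
          (ab.2 / ((Lam ^ n : ℕ) : ℝ)) t).card : ℝ)} with hcell
  -- Grid of mesh `Lam⁻¹ ^ n`: `y` ranges over a period `degree ^ n` of `hits`, and `s` over `[-J,
  -- J]`, since a slope that is hit is at most `ϑ ≤ J` in absolute value.
  set I : Finset (ℤ × ℤ) := Finset.Ico 0 (((G.degree * Lam) ^ n : ℕ) : ℤ) ×ˢ
    Finset.Icc (-((J * Lam ^ n : ℕ) : ℤ)) ((J * Lam ^ n : ℕ) : ℤ) with hI
  have hLn : 0 < Lam ^ n := pow_pos (by omega) n
  have hLn' : (0 : ℝ) < ((Lam ^ n : ℕ) : ℝ) := by exact_mod_cast hLn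
  have hLinv : (((Lam ^ n : ℕ) : ℝ))⁻¹ = (Lam : ℝ)⁻¹ ^ n := by push_cast; rw [inv_pow]
  have hcover : {t : Fin D → ℝ | (∀ i, |t i| ≤ ε) ∧
        ϱ ^ n ≤ (G.multiplicity ϑ (fun u => g u + ∑ i, t i * φ i u) n : ℝ) ∧
        2 * p ^ 2 * (K * G.multiplicity ϑ (fun u => g u + ∑ i, t i * φ i u) (n - q))
          ≤ G.multiplicity ϑ (fun u => g u + ∑ i, t i * φ i u) n} ⊆ ⋃ ab ∈ I, cell ab := by
    rintro t ⟨ht1, ht2, ht3⟩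
    obtain ⟨y, s, hy0, hy1, hys⟩ := G.exists_card_hits_eq_of_mem_Ico (hper t) ϑ n
    have hpos : 0 < (G.hits ϑ (fun u => g u + ∑ i, t i * φ i u) n y s).card := by
      rw [hys]
      have : (0 : ℝ) < ϱ ^ n := by positivity
      exact_mod_cast this.trans_le ht2
    have hsϑ : |s| ≤ ϑ := by
      obtain ⟨m, hm⟩ := Finset.card_pos.1 hpos
      have h1 := (G.mem_hits.1 hm).2
      have h2 := G.abs_slope_add_le hlam h (hbd t ht1) n (y + m)
      have h3 := abs_sub_abs_le_abs_sub s (G.slope (fun u => g u + ∑ i, t i * φ i u) n (y + m))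
      rw [abs_sub_comm s] at h3
      linarith
    refine Set.mem_biUnion (x := (⌊y * (Lam ^ n : ℕ)⌋, ⌊s * (Lam ^ n : ℕ)⌋)) ?_ ⟨ht1, ?_⟩
    · simp only [hI, Finset.coe_product, Set.mem_prod, Finset.coe_Ico, Finset.coe_Icc, Set.mem_Ico,
        Set.mem_Icc]
      refine ⟨⟨Int.floor_nonneg.2 (by positivity), Int.floor_lt.2 ?_⟩, Int.le_floor.2 ?_, ?_⟩
      · push_cast
        rw [mul_pow]
        exact mul_lt_mul_of_pos_right hy1 (by positivity)
      · have h1 : -(J : ℝ) ≤ s := by linarith [(abs_le.1 hsϑ).1]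
        have := mul_le_mul_of_nonneg_right h1 hLn'.le
        push_cast at this ⊢
        linarith
      · have h1 : s ≤ (J : ℝ) := by linarith [(abs_le.1 hsϑ).2]
        have := (Int.floor_le (s * (Lam ^ n : ℕ))).trans (mul_le_mul_of_nonneg_right h1 hLn'.le)
        exact_mod_cast this
    · have hgy := exists_grid_point hLn y
      have hgs := exists_grid_point hLn s
      rw [hLinv] at hgy hgs
      have hmain := G.pow_le_two_mul_card_clusters (p := p) hlam h (by exact_mod_cast hLam) h' hB0 hBlip hB
        (hqK.trans hn) hρ hϑ0 (hper t) (hbd t ht1) (hlip t ht1) hgy hgs (hys ▸ ht3)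
      rw [hys] at hmain
      have h1 : (ϱ ^ n) ^ p ≤
          (G.multiplicity ϑ (fun u => g u + ∑ i, t i * φ i u) n : ℝ) ^ p :=
        pow_le_pow_left₀ (by positivity) ht2 p
      have h2 := Nat.cast_le (α := ℝ).2 hmain
      rw [Nat.cast_pow, Nat.cast_mul, Nat.cast_two] at h2
      rw [hX, div_le_iff₀ two_pos, mul_comm _ (2 : ℝ)]
      exact h1.trans h2
  have hcellv : ∀ ab ∈ I, volume (cell ab) ≤ ENNReal.ofReal (V / X) := fun ab _ =>
    G.volume_clusters_le hlam h hLam0 h' hq hqK hn hη hη1 hηq hsmall hφ hbump _ _ g hC₁0 hε hX0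
      (G.sum_weight_le hlam h hB0 hB n _)
  have hIcard : (I.card : ℝ) ≤ (2 * J + 1) * (G.degree * Lam ^ 2) ^ n := by
    have h1 : I.card = (G.degree * Lam) ^ n * (2 * (J * Lam ^ n) + 1) := by
      rw [hI, Finset.card_product, Int.card_Ico, Int.card_Icc, sub_zero, Int.toNat_natCast]
      congr 1
      omega
    rw [h1]
    have h2 : (1 : ℝ) ≤ (Lam : ℝ) ^ n := one_le_pow₀ (by exact_mod_cast hLam)
    push_cast
    have e : (2 * (J : ℝ) + 1) * (G.degree * (Lam : ℝ) ^ 2) ^ n =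
        (G.degree * (Lam : ℝ)) ^ n * ((2 * J + 1) * (Lam : ℝ) ^ n) := by
      rw [mul_pow, mul_pow, ← pow_mul, mul_comm 2 n, pow_mul]; ring
    rw [e]
    gcongr
    linarith
  calc _ ≤ volume (⋃ ab ∈ I, cell ab) := measure_mono hcover
    _ ≤ ∑ ab ∈ I, volume (cell ab) := measure_biUnion_finset_le _ _
    _ ≤ I.card • ENNReal.ofReal (V / X) := Finset.sum_le_card_nsmul _ _ _ hcellv
    _ = ENNReal.ofReal (I.card * (V / X)) := by
        rw [nsmul_eq_mul, ENNReal.ofReal_mul (Nat.cast_nonneg _), ENNReal.ofReal_natCast]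
    _ ≤ ENNReal.ofReal (((2 * J + 1) * (G.degree * Lam ^ 2) ^ n) * (V / X)) := by
        have : 0 ≤ V / X := by positivity
        exact ENNReal.ofReal_le_ofReal (mul_le_mul_of_nonneg_right hIcard this)
    _ = _ := by
        congr 1
        rw [hX, div_pow, ← pow_mul, ← pow_mul, mul_comm n p]
        field_simp

end InverseLift

end PartialCaptivity

/-! ### Choice of the scales, Borel–Cantelli and density. -/

namespace PartialCaptivity

variable {r : ℕ}

namespace CrCircle

theorem deriv_add_sum_onReal (hr : r ≠ 0) {D : ℕ} (τ : CrCircle r) (φ : Fin D → CrCircle r)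
    (t : Fin D → ℝ) :
    deriv (τ + ∑ i, t i • φ i).onReal =
      fun u => deriv τ.onReal u + ∑ i, t i * deriv (φ i).onReal u := by
  funext u
  rw [deriv_add_onReal hr]
  congr 1
  induction (Finset.univ : Finset (Fin D)) using Finset.induction_on with
  | empty =>
    rw [Finset.sum_empty, Finset.sum_empty]
    exact deriv_const u (0 : ℝ)
  | insert a s ha ih =>
    rw [Finset.sum_insert ha, Finset.sum_insert ha, deriv_add_onReal hr, ih, onReal_smul]
    congr 1
    exact deriv_const_smul (t a) ((φ a).contDiff_onReal.differentiable (by exact_mod_cast hr) u)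

theorem norm_sum_smul_le {D : ℕ} (φ : Fin D → CrCircle r) {t : Fin D → ℝ} {δ : ℝ} (hδ : 0 < δ)
    (ht : ∀ i, |t i| ≤ δ / (∑ i, ‖φ i‖ + 1)) : ‖∑ i, t i • φ i‖ ≤ δ := by
  have h0 : 0 ≤ ∑ i, ‖φ i‖ := Finset.sum_nonneg fun i _ => norm_nonneg _
  calc _ ≤ ∑ i, ‖t i • φ i‖ := norm_sum_le _ _
    _ ≤ ∑ i, δ / (∑ i, ‖φ i‖ + 1) * ‖φ i‖ := by
        refine Finset.sum_le_sum fun i _ => ?_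
        rw [norm_smul, Real.norm_eq_abs]
        exact mul_le_mul_of_nonneg_right (ht i) (norm_nonneg _)
    _ = δ / (∑ i, ‖φ i‖ + 1) * ∑ i, ‖φ i‖ := by rw [Finset.mul_sum]
    _ ≤ δ := by
        rw [div_mul_eq_mul_div, div_le_iff₀ (by linarith)]
        nlinarith

end CrCircle

/-- If `a n ≥ β ^ (2 n)` held for all `n ≥ 1`, the hypothesis would bound the growth over `q` steps
by `β ^ q`, too slow for the factor `β ^ (2 q)` required. -/
theorem exists_lt_pow_of_lt_mul {a : ℕ → ℕ} {β : ℝ} (hβ : 1 < β) {q N A : ℕ} (hq : 1 ≤ q)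
    (hA : (A : ℝ) ≤ β ^ q)
    (ha : ∀ n, N ≤ n → (β ^ 2) ^ n ≤ (a n : ℝ) → a n < A * a (n - q)) :
    ∃ n, n ≠ 0 ∧ (a n : ℝ) < (β ^ 2) ^ n := by
  by_contra! hcon
  have hβ0 : 0 < β := by linarith
  have hstep : ∀ j : ℕ, (a (N + 1 + q * j) : ℝ) ≤ (β ^ q) ^ j * a (N + 1) := by
    intro j
    induction j with
    | zero => simp
    | succ j ih =>
      have h1 := ha (N + 1 + q * (j + 1)) (by omega) (hcon _ (by omega))
      rw [show N + 1 + q * (j + 1) - q = N + 1 + q * j by rw [mul_add]; omega] at h1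
      have h2 : (a (N + 1 + q * (j + 1)) : ℝ) ≤ A * a (N + 1 + q * j) := by exact_mod_cast h1.le
      calc _ ≤ (A : ℝ) * a (N + 1 + q * j) := h2
        _ ≤ β ^ q * ((β ^ q) ^ j * a (N + 1)) := by gcongr
        _ = _ := by ring
  obtain ⟨j, hj⟩ := pow_unbounded_of_one_lt (a (N + 1) : ℝ) (one_lt_pow₀ hβ (by omega : q ≠ 0))
  have h1 := (hcon (N + 1 + q * j) (by omega)).trans (hstep j)
  have h2 : ((β ^ q) ^ j) * (β ^ q) ^ j ≤ (β ^ 2) ^ (N + 1 + q * j) := by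
    rw [← pow_mul, ← pow_mul, ← pow_add]
    exact pow_le_pow_right₀ hβ.le (by nlinarith)
  have h3 : 0 < (β ^ q) ^ j := by positivity
  have h4 := le_of_mul_le_mul_left (h2.trans h1) h3
  linarith

theorem exists_scales {lam : ℝ} (hlam : 1 < lam) {Lam : ℕ} (hLam : 1 ≤ Lam) {β : ℝ} (hβ : 1 < β)
    (p : ℕ) {c : ℝ} (hc : 0 ≤ c) :
    ∃ q K : ℕ, 1 ≤ q ∧ q ≤ K ∧ (2 * p ^ 2 * K : ℝ) ≤ β ^ q ∧
      c * lam⁻¹ ^ K ≤ ((Lam : ℝ)⁻¹ ^ q / 8) ^ p / 4 := by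
  have hLam0 : (1 : ℝ) ≤ Lam := by exact_mod_cast hLam
  -- With `K = (κ + 1) * q` and `κ` independent of `q`, the quantity `lam⁻¹ ^ K` beats `(Lam⁻¹ ^ q /
  -- 8) ^ p` for every `q ≥ 1`, while `2 p² K` is only linear in `q` and is overtaken by `β ^ q`.
  obtain ⟨κ, hκ⟩ := pow_unbounded_of_one_lt (4 * (c + 1) * (8 * (Lam : ℝ)) ^ p) hlam
  have hκ' : 4 * (c + 1) * (8 * (Lam : ℝ)) ^ p ≤ lam ^ (κ + 1) :=
    hκ.le.trans (pow_le_pow_right₀ hlam.le (Nat.le_succ κ))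
  have ht : Tendsto (fun q : ℕ => (q : ℝ) ^ 1 * β⁻¹ ^ q) atTop (𝓝 0) :=
    tendsto_pow_const_mul_const_pow_of_abs_lt_one 1
      (by rw [abs_inv, abs_of_pos (by linarith)]; exact inv_lt_one_of_one_lt₀ hβ)
  have hpos : (0 : ℝ) < 1 / (2 * p ^ 2 * (κ + 1) + 1) := by positivity
  obtain ⟨q, hq1, hq⟩ := ((ht.eventually (eventually_le_nhds hpos)).and
    (eventually_ge_atTop 1)).exists
  refine ⟨q, (κ + 1) * q, hq, Nat.le_mul_of_pos_left q (Nat.succ_pos κ), ?_, ?_⟩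
  · have hβq : 0 < β ^ q := by positivity
    rw [pow_one, inv_pow, ← div_eq_mul_inv, div_le_iff₀ hβq, div_mul_eq_mul_div, one_mul,
      le_div_iff₀ (by positivity)] at hq1
    push_cast
    have : (0 : ℝ) ≤ q := q.cast_nonneg
    nlinarith
  · have h1 : 4 * (c + 1) * (8 * (Lam : ℝ) ^ q) ^ p ≤ lam ^ ((κ + 1) * q) := by
      rw [pow_mul]
      refine le_trans ?_ (pow_le_pow_left₀ (by positivity) hκ' q)
      rw [mul_pow (4 * (c + 1)), ← pow_mul, mul_comm p q, pow_mul, mul_pow 8 (Lam : ℝ) q]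
      have h2 : (8 : ℝ) ≤ 8 ^ q := le_self_pow₀ (by norm_num) (by omega)
      have h3 : 4 * (c + 1) ≤ (4 * (c + 1)) ^ q := le_self_pow₀ (by linarith) (by omega)
      gcongr
    have hl : 0 < lam ^ ((κ + 1) * q) := by positivity
    have e : ((Lam : ℝ)⁻¹ ^ q / 8) ^ p = ((8 * (Lam : ℝ) ^ q) ^ p)⁻¹ := by
      rw [← inv_pow]; congr 1; rw [mul_inv, inv_pow]; ring
    rw [e, inv_pow, ← div_eq_mul_inv, div_le_iff₀ hl, div_mul_eq_mul_div, le_div_iff₀ (by norm_num),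
      inv_mul_eq_div, le_div_iff₀ (by positivity)]
    refine le_trans ?_ h1
    have : (0 : ℝ) < (8 * (Lam : ℝ) ^ q) ^ p := by positivity
    nlinarith

open MeasureTheory in
theorem dense_growthRateLT (E : ExpandingMap r) (hr : 2 ≤ r) {ϱ : ℝ} (hϱ : 1 < ϱ) :
    Dense (growthRateLT E (by omega : r ≠ 0) ϱ) := by
  have hr0 : r ≠ 0 := by omega
  obtain ⟨lam, hlam, hlamE⟩ := E.exists_le_derivative
  obtain ⟨Lam, hLam2, h'⟩ := E.exists_inv_le_rate hr0
  obtain ⟨B, hB0, hBlip, hB⟩ := E.exists_rate_lipschitz hr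
  set G := E.inverseLift hr0 with hG
  have h : ∀ u, G.rate u ≤ lam⁻¹ := E.rate_inverseLift_le hr0 (by linarith) hlamE
  have hl : 0 < lam - 1 := by linarith
  have hLam : 1 ≤ Lam := by omega
  have hLam0 : (0 : ℝ) < Lam := by exact_mod_cast hLam
  set β := √ϱ with hβ
  have hβ2 : β ^ 2 = ϱ := Real.sq_sqrt (by linarith)
  have hβ1 : 1 < β := by rw [hβ, Real.lt_sqrt (by norm_num)]; linarith
  -- The choice of `p` makes `ϱ ^ p` exceed twice the growth factor of the number of grid points.
  -- Then `q` and `K` are chosen from `p`, next `η`, and finally the bumps.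
  obtain ⟨p, hp⟩ := pow_unbounded_of_one_lt (2 * (G.degree * (Lam : ℝ) ^ 2)) hϱ
  set c := p.factorial * (1 + 1 / (lam - 1)) ^ p / (lam - 1) with hc
  have hc0 : 0 < c := by positivity
  obtain ⟨q, K, hq, hqK, hA, hK⟩ := exists_scales hlam hLam hβ1 p hc0.le
  set d := (Lam : ℝ)⁻¹ ^ q with hd
  have hd0 : 0 < d := by positivity
  have hd1 : d ≤ 1 := pow_le_one₀ (by positivity)
    (inv_le_one_of_one_le₀ (by exact_mod_cast hLam))
  set η := min (1 / 8) (min (d / 8 * (lam - 1)) ((d / 8) ^ p / 4 / c)) with hη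
  have hη0 : 0 < η := lt_min (by norm_num) (lt_min (by positivity) (by positivity))
  have hη1 : η ≤ 1 / 8 := min_le_left _ _
  have hηq : η / (lam - 1) ≤ d / 8 := by
    rw [div_le_iff₀ hl]
    exact (min_le_right _ _).trans (min_le_left _ _)
  have hηc : c * η ≤ (d / 8) ^ p / 4 := by
    rw [mul_comm, ← le_div_iff₀ hc0]
    exact (min_le_right _ _).trans (min_le_right _ _)
  have hsmall : p.factorial * ((η + lam⁻¹ ^ K) / (lam - 1) * (1 + 1 / (lam - 1)) ^ p) ≤
      (d / 8) ^ p / 2 := by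
    have e : p.factorial * ((η + lam⁻¹ ^ K) / (lam - 1) * (1 + 1 / (lam - 1)) ^ p) =
        c * η + c * lam⁻¹ ^ K := by rw [hc]; ring
    rw [e]
    linarith
  obtain ⟨D, φ, hφ, hbump⟩ := exists_bumps r (ρ := d / 2) (η := η) (by positivity) (by linarith)
    hη0 (by linarith)
  rw [Metric.dense_iff]
  intro τ δ hδ
  set ε := δ / 2 / (∑ i, ‖φ i‖ + 1) with hε
  have hε0 : 0 < ε := by
    have : 0 ≤ ∑ i, ‖φ i‖ := Finset.sum_nonneg fun i _ => norm_nonneg _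
    positivity
  -- One constant that is admissible for all perturbations considered at once.
  set R := ‖τ‖ + δ with hR
  have hnorm : ∀ t : Fin D → ℝ, (∀ i, |t i| ≤ ε) → ‖∑ i, t i • φ i‖ ≤ δ / 2 :=
    fun t ht => CrCircle.norm_sum_smul_le φ (by positivity) ht
  have hnorm' : ∀ t : Fin D → ℝ, (∀ i, |t i| ≤ ε) → ‖τ + ∑ i, t i • φ i‖ < R := fun t ht =>
    (norm_add_le _ _).trans_lt (by linarith [hnorm t ht])
  obtain ⟨C, hC0, hC⟩ := G.exists_volume_overlap_le hlam h hLam h' hB0 hBlip hB (p := p) hq hqK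
    (ρ := d / 2) (by linarith) hη0 (by linarith) hηq hsmall
    (φ := fun i => deriv (φ i).onReal) hφ hbump (g := deriv τ.onReal) (R := R) (ε := ε) (ϱ := ϱ)
    hε0 (by linarith)
    (fun t => by
      rw [← CrCircle.deriv_add_sum_onReal hr0]; exact CrCircle.periodic_deriv_onReal _)
    (fun t ht u => by
      have := CrCircle.abs_deriv_le hr0 (τ + ∑ i, t i • φ i) u
      rw [CrCircle.deriv_add_sum_onReal hr0] at this
      exact this.trans (hnorm' t ht).le)
    (fun t ht u v => by
      have := CrCircle.abs_deriv_sub_deriv_le hr (τ + ∑ i, t i • φ i) u v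
      rw [CrCircle.deriv_add_sum_onReal hr0] at this
      exact this.trans (mul_le_mul_of_nonneg_right (hnorm' t ht).le (abs_nonneg _)))
  set bad : ℕ → Set (Fin D → ℝ) := fun n => {t | (∀ i, |t i| ≤ ε) ∧
      ϱ ^ n ≤ (G.multiplicity (R / (lam - 1))
        (fun u => deriv τ.onReal u + ∑ i, t i * deriv (φ i).onReal u) n : ℝ) ∧
      2 * p ^ 2 * (K * G.multiplicity (R / (lam - 1))
        (fun u => deriv τ.onReal u + ∑ i, t i * deriv (φ i).onReal u) (n - q)) ≤
        G.multiplicity (R / (lam - 1))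
          (fun u => deriv τ.onReal u + ∑ i, t i * deriv (φ i).onReal u) n} with hbad
  have hratio : G.degree * (Lam : ℝ) ^ 2 / ϱ ^ p ≤ 1 / 2 := by
    rw [div_le_iff₀ (by positivity)]
    linarith
  have hsum : ∑' n, volume (bad (n + K)) ≠ ∞ := by
    have hs : Summable fun n : ℕ => C * (1 / 2 : ℝ) ^ n :=
      (summable_geometric_of_lt_one (by norm_num) (by norm_num)).mul_left C
    refine ne_top_of_le_ne_top (b := ENNReal.ofReal (∑' n : ℕ, C * (1 / 2 : ℝ) ^ n))
      ENNReal.ofReal_ne_top ?_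
    rw [ENNReal.ofReal_tsum_of_nonneg (fun n => by positivity) hs]
    refine ENNReal.tsum_le_tsum fun n => (hC (n + K) (by omega)).trans ?_
    refine ENNReal.ofReal_le_ofReal (mul_le_mul_of_nonneg_left ?_ hC0)
    refine (pow_le_pow_left₀ (by positivity) hratio _).trans ?_
    exact pow_le_pow_of_le_one (by norm_num) (by norm_num) (by omega)
  have hlimsup := measure_limsup_atTop_eq_zero hsum
  -- The cube of parameters has positive volume, while the parameters that are bad infinitely often
  -- form a null set.
  obtain ⟨t, ht, htn⟩ : ∃ t ∈ Set.Icc (fun _ : Fin D => -ε) (fun _ => ε),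
      t ∉ limsup (fun n => bad (n + K)) atTop := by
    by_contra! hcon
    have h1 : volume (Set.Icc (fun _ : Fin D => -ε) (fun _ => ε)) = 0 :=
      measure_mono_null hcon hlimsup
    rw [Real.volume_Icc_pi] at h1
    obtain ⟨i, -, hi⟩ := Finset.prod_eq_zero_iff.1 h1
    rw [ENNReal.ofReal_eq_zero] at hi
    linarith
  have ht' : ∀ i, |t i| ≤ ε := fun i => abs_le.2 ⟨ht.1 i, ht.2 i⟩
  rw [mem_limsup_iff_frequently_mem, not_frequently, eventually_atTop] at htn
  obtain ⟨N, hN⟩ := htn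
  refine ⟨τ + ∑ i, t i • φ i, ?_, lam, R, ⟨hlam, hlamE, ?_⟩, ?_⟩
  · rw [Metric.mem_ball, dist_eq_norm, add_sub_cancel_left]
    linarith [hnorm t ht']
  · exact (CrCircle.supDerivative_le hr0 _).trans_lt (hnorm' t ht')
  · rw [CrCircle.deriv_add_sum_onReal hr0, ← hβ2]
    refine exists_lt_pow_of_lt_mul hβ1 (q := q) (N := N + K) (A := 2 * p ^ 2 * K) hq
      (by exact_mod_cast hA) fun n hn hle => ?_
    rw [hβ2] at hle
    by_contra! hcon
    have hmem : t ∈ bad (n - K + K) := by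
      rw [Nat.sub_add_cancel (by omega)]
      exact ⟨ht', hle, by rwa [← mul_assoc]⟩
    exact hN (n - K) (by omega) hmem

end PartialCaptivity

theorem theorem1 (r : ℕ) (hr : 2 ≤ r) (E : PartialCaptivity.ExpandingMap r) :
    (∀ ϱ : ℝ, 1 < ϱ → ∃ V : Set (PartialCaptivity.CrCircle r), IsOpen V ∧ Dense V ∧
      ∀ τ ∈ V, ∃ L : ℝ≥0∞, PartialCaptivity.IsGrowthRate E τ L ∧ L < ENNReal.ofReal ϱ) ∧
    (∃ S : Set (PartialCaptivity.CrCircle r), S ∈ residual (PartialCaptivity.CrCircle r) ∧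
      ∀ τ ∈ S, PartialCaptivity.PartiallyCaptive E τ) := by
  have hr0 : r ≠ 0 := by omega
  refine ⟨fun ϱ hϱ => ⟨PartialCaptivity.growthRateLT E hr0 ϱ,
    PartialCaptivity.isOpen_growthRateLT E hr0 ϱ, PartialCaptivity.dense_growthRateLT E hr hϱ,
    fun τ hτ => PartialCaptivity.exists_isGrowthRate_lt (by linarith) hτ⟩,
    ⋂ k : ℕ, PartialCaptivity.growthRateLT E hr0 (1 + 1 / (k + 1)), ?_, fun τ hτ =>
    PartialCaptivity.partiallyCaptive_of_forall_mem (Set.mem_iInter.1 hτ)⟩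
  refine countable_iInter_mem.2 fun k => residual_of_dense_open
    (PartialCaptivity.isOpen_growthRateLT E hr0 _)
    (PartialCaptivity.dense_growthRateLT E hr ?_)
  have : (0 : ℝ) < 1 / ((k : ℝ) + 1) := by positivity
  linarith
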